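/- Consider the eigenvalue problem $-u''=\lambda u$ on $(-1,1)$, $\lambda\in\mathbb R$, $0\not\equiv u\in C^2[-1,1]$, with the multi-point boundary conditions $$\alpha_0^\pm u(\pm1)+\beta_0^\pm u'(\pm1)=\sum_{i=1}^{m^\pm}\alpha_i^\pm u(\eta_i^\pm)+\sum_{i=1}^{m^\pm}\beta_i^\pm u'(\eta_i^\pm),$$ where $m^\pm\ge1$ are integers, all coefficients are real, $\eta_i^\pm\in[-1,1]$, $\eta_i^\pm\neq\pm1$. Suppose that $$\alpha_0^\pm\ge0,\qquad \alpha_0^\pm+|\beta_0^\pm|>0,\qquad \pm\beta_0^\pm\ge0,\qquad \Big(\frac{\sum_i|\alpha_i^\pm|}{\alpha_0^\pm}\Big)^2+\Big(\frac{\sum_i|\beta_i^\pm|}{\beta_0^\pm}\Big)^2<1,$$ where, if a denominator is zero, the corresponding numerator must also be zero and the fraction is omitted. Write $\alpha^\pm=(\alpha_1^\pm,\dots,\alpha_{m^\pm}^\pm)$ and $\beta^\pm=(\beta_1^\pm,\dots,\beta_{m^\pm}^\pm)$. For $k\ge0$, let $S_k$ be the set of $u\in C^2[-1,1]$ such that $u(\pm1)\ne0$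 and $u$ has exactly $k$ zeros in $(-1,1)$, all of them simple. Let $T_k$ be the set of $u\in C^2[-1,1]$ such that $u'(\pm1)\neq0$, $u'$ has exactly $k$ zeros in $(-1,1)$, all of them simple zeros of $u'$, and $u$ has a zero strictly between any two consecutive zeros of $u'$. Let $\lambda_0^D<\lambda_1^D<\cdots$ and $\lambda_0^N<\lambda_1^N<\cdots$ be the eigenvalues of $-u''=\lambda u$ on $(-1,1)$ with the conditions $u(\pm1)=0$, respectively $u'(\pm1)=0$, and set $\lambda_{-1}^D=\lambda_{-2}^D=0$. In each of the cases (a), (b), (c) below, the set of eigenvalues of the multi-point problem is a strictly increasing sequence $\lambda_0<\lambda_1<\cdots$, and each $\lambda_k$ has geometric multiplicity one; let $\psi_k$ be an eigenfunction of $\lambda_k$. Moreover: (a) If $\alpha_0^\pm>0$ and $\beta^\pm=0$ (at both end points), then for all $k\ge0$: $\psi_k\in T_{k+1}$ and $\lambda_k^N<\lambda_k<\lambda_{k+2}^N$. (b) If $\alpha^\pm=0$ and $\pm\beta_0^\pm>0$ (at both end points), then for all $k\ge0$: $\psi_k\in S_k$ and $\lambda_{k-2}^D<\lambda_k<\lambda_k^D$,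 except that if $k=0$ and $\alpha_0^-=\alpha_0^+=0$ then the lower bound is replaced by $\lambda_0=0$. (c) If $\pm\beta_0^\pm>0$ (at both end points), then for all sufficiently large $k$: $\psi_k\in S_k$ and $\lambda_{k-2}^D<\lambda_k<\lambda_k^D$. -/

import Mathlib

open Set Filter

noncomputable section

namespace MultiPoint

/-- The interval `[-1,1]`. -/
abbrev I : Set ℝ := Icc (-1) 1

/-- First derivative on `[-1,1]` (one-sided at the end points). -/
def D1 (u : ℝ → ℝ) : ℝ → ℝ := derivWithin u I

/-- Second derivative on `[-1,1]` (one-sided at the end points). -/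
def D2 (u : ℝ → ℝ) : ℝ → ℝ := derivWithin (D1 u) I

/-- The coefficients of a multi-point boundary condition
`α₀ u(ν) + β₀ u'(ν) = ∑ αᵢ u(ηᵢ) + ∑ βᵢ u'(ηᵢ)` at one end point `ν = ±1`. -/
structure EndCondition where
  m : ℕ
  α₀ : ℝ
  β₀ : ℝ
  α : Fin m → ℝ
  β : Fin m → ℝ
  η : Fin m → ℝ

/-- `u` satisfies the boundary condition `E` at the end point `ν`. -/
def EndCondition.Holds (E : EndCondition) (ν : ℝ) (u : ℝ → ℝ) : Prop :=
  E.α₀ * u ν + E.β₀ * D1 u ν = ∑ i, E.α i * u (E.η i) + ∑ i, E.β i * D1 u (E.η i)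

/-- Standing hypotheses on the boundary condition at the end point `ν` (`ν = -1` or `ν = 1`).
In the last clause a fraction with zero denominator has the value `0` in Lean, that is, it is
omitted; the two clauses before it say that the corresponding numerator is then zero too. -/
structure EndCondition.Admissible (E : EndCondition) (ν : ℝ) : Prop where
  one_le_m : 1 ≤ E.m
  η_mem : ∀ i, E.η i ∈ I
  η_ne : ∀ i, E.η i ≠ ν
  α₀_nonneg : 0 ≤ E.α₀
  nontrivial : 0 < E.α₀ + |E.β₀|
  β₀_sign : 0 ≤ ν * E.β₀
  α_zero : E.α₀ = 0 → ∑ i, |E.α i| = 0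
  β_zero : E.β₀ = 0 → ∑ i, |E.β i| = 0
  small : ((∑ i, |E.α i|) / E.α₀) ^ 2 + ((∑ i, |E.β i|) / E.β₀) ^ 2 < 1

/-- A pair of multi-point boundary conditions, `left` at `-1` and `right` at `1`. -/
structure Problem where
  left : EndCondition
  right : EndCondition

namespace Problem

structure Admissible (P : Problem) : Prop where
  left : P.left.Admissible (-1)
  right : P.right.Admissible 1

/-- `u` (restricted to `[-1,1]`) is an eigenfunction, with eigenvalue `lam`, of `-u'' = lam u`
on `(-1,1)` with the boundary conditions of `P`. -/
structure IsEigenfunction (P : Problem) (lam : ℝ) (u : ℝ → ℝ) : Prop where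
  contDiffOn : ContDiffOn ℝ 2 u I
  bc_left : P.left.Holds (-1) u
  bc_right : P.right.Holds 1 u
  ode : ∀ x ∈ Ioo (-1 : ℝ) 1, -D2 u x = lam * u x
  nontrivial : ∃ x ∈ I, u x ≠ 0

/-- The set of (real) eigenvalues. -/
def spec (P : Problem) : Set ℝ := {lam | ∃ u, P.IsEigenfunction lam u}

/-- The `k`-th eigenvalue (`k = 0, 1, …`) in increasing order: the least eigenvalue
that has at least `k` eigenvalues below it. -/
def eigenvalue (P : Problem) (k : ℕ) : ℝ :=
  sInf {lam | lam ∈ P.spec ∧ (k : ℕ∞) ≤ (P.spec ∩ Iio lam).encard}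

/-- The eigenvalues form the strictly increasing sequence `P.eigenvalue 0 < P.eigenvalue 1 < ⋯`,
and each of them has geometric multiplicity one. -/
structure HasSimpleSpectrum (P : Problem) : Prop where
  strictMono : StrictMono P.eigenvalue
  range_eq : range P.eigenvalue = P.spec
  simple : ∀ k u v, P.IsEigenfunction (P.eigenvalue k) u → P.IsEigenfunction (P.eigenvalue k) v →
    ∃ c : ℝ, EqOn v (fun x => c * u x) I

/-- Sanity check: `P.eigenvalue` is any strictly increasing enumeration of the spectrum. -/
theorem eigenvalue_eq (P : Problem) {f : ℕ → ℝ} (hf : StrictMono f) (hr : range f = P.spec)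
    (k : ℕ) : P.eigenvalue k = f k := by
  have key : ∀ n, (P.spec ∩ Iio (f n)).encard = (n : ℕ∞) := by
    intro n
    have h : P.spec ∩ Iio (f n) = f '' (Iio n) := by
      rw [← hr]
      ext x
      constructor
      · rintro ⟨⟨j, rfl⟩, hj⟩
        exact ⟨j, hf.lt_iff_lt.1 hj, rfl⟩
      · rintro ⟨j, hj, rfl⟩
        exact ⟨⟨j, rfl⟩, hf hj⟩
    rw [h, hf.injective.encard_image, ← Finset.coe_Iio, encard_coe_eq_coe_finsetCard, Nat.card_Iio]
  apply IsLeast.csInf_eq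
  refine ⟨⟨hr ▸ ⟨k, rfl⟩, (key k).ge⟩, ?_⟩
  rintro x ⟨hx, hk⟩
  rw [← hr] at hx
  obtain ⟨j, rfl⟩ := hx
  rw [key j] at hk
  exact hf.monotone (by exact_mod_cast hk)

end Problem

/-- The single-point condition `a u(ν) + b u'(ν) = 0`. -/
def singlePoint (a b : ℝ) : EndCondition := ⟨1, a, b, 0, 0, 0⟩

/-- The Dirichlet problem `u(±1) = 0`. -/
def dirichlet : Problem := ⟨singlePoint 1 0, singlePoint 1 0⟩

/-- The Neumann problem `u'(±1) = 0`. -/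
def neumann : Problem := ⟨singlePoint 0 (-1), singlePoint 0 1⟩

/-- The `j`-th Neumann eigenvalue. -/
def lamN (j : ℕ) : ℝ := neumann.eigenvalue j

/-- The `j`-th Dirichlet eigenvalue, with the convention that it is `0` for negative `j`. -/
def lamD (j : ℤ) : ℝ := if 0 ≤ j then dirichlet.eigenvalue j.toNat else 0

/-- The nodal set `S_k^+`. -/
def SPlus (k : ℕ) : Set (ℝ → ℝ) :=
  {u | ContDiffOn ℝ 2 u I ∧ u (-1) ≠ 0 ∧ u 1 ≠ 0 ∧ 0 < u (-1) ∧
    (∀ x ∈ Ioo (-1 : ℝ) 1, u x = 0 → D1 u x ≠ 0) ∧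
    {x | x ∈ Ioo (-1 : ℝ) 1 ∧ u x = 0}.encard = k}

/-- The nodal set `S_k = S_k^+ ∪ (-S_k^+)`. -/
def S (k : ℕ) : Set (ℝ → ℝ) := SPlus k ∪ {u | -u ∈ SPlus k}

/-- The nodal set `T_k^+`. -/
def TPlus (k : ℕ) : Set (ℝ → ℝ) :=
  {u | ContDiffOn ℝ 2 u I ∧ D1 u (-1) ≠ 0 ∧ D1 u 1 ≠ 0 ∧ 0 < D1 u (-1) ∧
    (∀ x ∈ Ioo (-1 : ℝ) 1, D1 u x = 0 → D2 u x ≠ 0) ∧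
    {x | x ∈ Ioo (-1 : ℝ) 1 ∧ D1 u x = 0}.encard = k ∧
    ∀ x ∈ Ioo (-1 : ℝ) 1, ∀ y ∈ Ioo (-1 : ℝ) 1, x < y → D1 u x = 0 → D1 u y = 0 →
      (∀ z ∈ Ioo x y, D1 u z ≠ 0) → ∃ z ∈ Ioo x y, u z = 0}

/-- The nodal set `T_k = T_k^+ ∪ (-T_k^+)`. -/
def T (k : ℕ) : Set (ℝ → ℝ) := TPlus k ∪ {u | -u ∈ TPlus k}

end MultiPoint

end

noncomputable section

namespace MultiPoint

/-! For λ = s² with s > 0, every solution is a multiple of sin(s(x-1)+φ). The condition at 1 becomes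
Im(e^{iφ}σ(s)) = 0, where σ(s) = α₀ + isβ₀ - Σ(αᵢ + isβᵢ)e^{i(ηᵢ-1)s} is `symbol`. By Cauchy-Schwarz
the smallness hypothesis makes the sum shorter than α₀ + isβ₀, a vector of the closed first
quadrant. So σ(s) avoids 0 and the negative real axis and has a continuous argument, `shift`; the
condition says φ ≡ -shift mod π. The condition at -1, reflected to 1, fixes 2s - φ mod π in the same
way. Hence s² is an eigenvalue iff `phase s`, which is 2s plus both shifts, is a multiple of π, and
the eigenfunction is then determined up to a factor.

The crux is that s + shift(s) is strictly increasing (`hasDerivAt_shift`, resting on `phase_ineq`).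
The phase starts in [0,π] and tends to infinity, so it takes each level (k+1)π exactly once, at
`root k`. For λ ≤ 0 a maximum argument at one end point excludes everything except the constants at
λ = 0 (`of_nonpos`).

The rest is read off from the range of the shifts: (-π/2, π/2) in case (a), (0, π) in case (b), and
(0, π) for large s in case (c). The argument of the sine runs from the left shift minus (k+1)π up to
minus the right shift, which fixes the number of zeros (`encard_zeros`). The identity 2s = (k+1)π -
shifts gives the bounds, since the Dirichlet phase is 2s and the Neumann phase is 2s + π. -/

/-! ### A trigonometric inequality -/

/-- Cauchy-Schwarz form of the smallness condition. -/
theorem sq_add_lt_of_small {a₀ b₀ κ μ : ℝ} (h : κ ^ 2 + μ ^ 2 < 1) (h0 : 0 < a₀ ^ 2 + b₀ ^ 2) :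
    (κ * a₀ + μ * b₀) ^ 2 < a₀ ^ 2 + b₀ ^ 2 := by
  nlinarith [sq_nonneg (κ * b₀ - μ * a₀)]

/-- If X < 0, the two expressions for X give p < μ and q < κ. When p, q ≥ 0 this contradicts p² + q²
= 1. When one is negative, comparing the two expressions and using `hM` gives 1 ≤ κ|q| + μ|p|,
against Cauchy-Schwarz. -/
theorem cross_nonneg {a₀ b₀ κ μ p q X Y Z : ℝ} (ha : 0 ≤ a₀) (hb : 0 ≤ b₀)
    (hκ : 0 ≤ κ) (h : κ ^ 2 + μ ^ 2 < 1) (hpq : p ^ 2 + q ^ 2 = 1)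
    (hM : 0 < a₀ * p + b₀ * q) (hY : |Y| ≤ μ * b₀) (hZ : |Z| ≤ κ * a₀)
    (hX : X = b₀ * p - Y) (hX' : X = a₀ * q + Z) : 0 ≤ X := by
  by_contra! hlt
  rw [abs_le] at hY hZ
  have h1 : b₀ * (p - μ) < 0 := by linarith
  have h2 : a₀ * (q - κ) < 0 := by linarith
  have hb' : 0 < b₀ := by
    rcases hb.eq_or_lt with rfl | hb'
    · simp at h1
    · exact hb'
  have ha' : 0 < a₀ := by
    rcases ha.eq_or_lt with rfl | ha'
    · simp at h2
    · exact ha'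
  have hp : p < μ := by
    by_contra! hc
    exact h1.not_ge (mul_nonneg hb (by linarith))
  have hq : q < κ := by
    by_contra! hc
    exact h2.not_ge (mul_nonneg ha (by linarith))
  rcases lt_or_ge p 0 with hp0 | hp0
  · have hq0 : 0 < q := by
      by_contra! hc
      nlinarith [mul_nonneg ha (neg_nonneg.2 hp0.le), mul_nonneg hb (neg_nonneg.2 hc)]
    have hpm : μ < -p := by nlinarith
    have e1 : b₀ * (-p - μ) ≤ a₀ * (κ - q) := by linarith
    have e2 : b₀ * (-p - μ) * q ≤ a₀ * (κ - q) * q := mul_le_mul_of_nonneg_right e1 hq0.le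
    have e3 : a₀ * (-p) * (-p - μ) ≤ b₀ * q * (-p - μ) :=
      mul_le_mul_of_nonneg_right (by linarith) (by linarith)
    -- Equivalent to p² + q² ≤ κq - μp, where the left side is 1 and the right side is below 1.
    have e4 : (-p) * (-p - μ) ≤ (κ - q) * q := by
      refine le_of_mul_le_mul_left ?_ ha'
      linarith
    nlinarith [sq_nonneg (κ - q), sq_nonneg (μ + p)]
  · rcases lt_or_ge q 0 with hq0 | hq0
    · have hp1 : 0 < p := by
        by_contra! hc
        nlinarith [mul_nonneg ha (neg_nonneg.2 hc), mul_nonneg hb (neg_nonneg.2 hq0.le)]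
      have hpm : κ < -q := by nlinarith
      have e1 : a₀ * (-q - κ) ≤ b₀ * (μ - p) := by linarith
      have e2 : a₀ * (-q - κ) * p ≤ b₀ * (μ - p) * p := mul_le_mul_of_nonneg_right e1 hp1.le
      have e3 : b₀ * (-q) * (-q - κ) ≤ a₀ * p * (-q - κ) :=
        mul_le_mul_of_nonneg_right (by linarith) (by linarith)
      have e4 : (-q) * (-q - κ) ≤ (μ - p) * p := by
        refine le_of_mul_le_mul_left ?_ hb'
        linarith
      nlinarith [sq_nonneg (κ + q), sq_nonneg (μ - p)]
    · nlinarith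

/-- Triangle inequality in ℂ: the two sums are the real and imaginary parts of a combination of the
unit vectors |c| + i|d| and |d| + i|c|. -/
theorem sum_abs_sq_le {m : ℕ} (a b c d : Fin m → ℝ) (h : ∀ i, c i ^ 2 + d i ^ 2 = 1) :
    (∑ i, (|a i| * |c i| + |b i| * |d i|)) ^ 2 + (∑ i, (|a i| * |d i| + |b i| * |c i|)) ^ 2 ≤
      (∑ i, |a i| + ∑ i, |b i|) ^ 2 := by
  have key : ‖∑ i, (((|a i| : ℝ) : ℂ) * ((|c i| : ℝ) + (|d i| : ℝ) * Complex.I) +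
      ((|b i| : ℝ) : ℂ) * ((|d i| : ℝ) + (|c i| : ℝ) * Complex.I))‖ ≤ ∑ i, |a i| + ∑ i, |b i| := by
    rw [← Finset.sum_add_distrib]
    refine norm_sum_le_of_le _ fun i _ => (norm_add_le _ _).trans (le_of_eq ?_)
    have e : ∀ x y : ℝ, x ^ 2 + y ^ 2 = 1 → ‖((|x| : ℝ) : ℂ) + (|y| : ℝ) * Complex.I‖ = 1 := by
      intro x y hxy
      rw [Complex.norm_add_mul_I, sq_abs, sq_abs, hxy, Real.sqrt_one]
    rw [norm_mul, norm_mul, e _ _ (h i), e _ _ ((add_comm _ _).trans (h i))]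
    simp
  have := pow_le_pow_left₀ (norm_nonneg _) key 2
  rw [Complex.sq_norm, Complex.normSq_apply, Complex.re_sum, Complex.im_sum] at this
  simpa [sq] using this

/-- Positivity of the derivative of the total phase, after rotating the symbol onto the positive
real axis: `hG` says its imaginary part vanishes, `hR` that its real part is positive. The term
without η exceeds U, which dominates the η-sum since |η| ≤ 1; the last bracket is nonnegative by
`cross_nonneg`. -/
theorem phase_ineq {m : ℕ} {a₀ b₀ κ μ s p q : ℝ} {a b η c d : Fin m → ℝ} (ha : 0 ≤ a₀)
    (hb : 0 ≤ b₀) (hs : 0 < s) (hκ : 0 ≤ κ) (h : κ ^ 2 + μ ^ 2 < 1)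
    (h0 : 0 < a₀ ^ 2 + (s * b₀) ^ 2)
    (hA : ∑ i, |a i| = κ * a₀) (hB : ∑ i, |b i| = μ * b₀) (hη : ∀ i, |η i| ≤ 1)
    (hpq : p ^ 2 + q ^ 2 = 1) (hcd : ∀ i, c i ^ 2 + d i ^ 2 = 1)
    (hG : s * b₀ * p - a₀ * q = ∑ i, (a i * d i + s * b i * c i))
    (hR : 0 < a₀ * p + s * b₀ * q - ∑ i, (a i * c i - s * b i * d i)) :
    0 < a₀ * p + s * b₀ * q - ∑ i, η i * (a i * c i - s * b i * d i)
      + (b₀ * p - ∑ i, b i * c i) := by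
  set U := ∑ i, (|a i| * |c i| + |s * b i| * |d i|) with hU
  set V := ∑ i, (|a i| * |d i| + |s * b i| * |c i|) with hV
  have hUV : U ^ 2 + V ^ 2 < a₀ ^ 2 + (s * b₀) ^ 2 := by
    refine (sum_abs_sq_le a (fun i => s * b i) c d hcd).trans_lt ?_
    simp only [abs_mul, abs_of_pos hs, ← Finset.mul_sum]
    rw [hA, hB, show s * (μ * b₀) = μ * (s * b₀) by ring]
    exact sq_add_lt_of_small h h0
  have hU0 : 0 ≤ U := Finset.sum_nonneg fun i _ => by positivity
  have term : ∀ i, |a i * c i - s * b i * d i| ≤ |a i| * |c i| + |s * b i| * |d i| := fun i => by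
    refine (abs_sub _ _).trans (le_of_eq ?_)
    rw [abs_mul, abs_mul (s * b i)]
  have hVG : |s * b₀ * p - a₀ * q| ≤ V := by
    rw [hG]
    refine (Finset.abs_sum_le_sum_abs _ _).trans (Finset.sum_le_sum fun i _ => ?_)
    refine (abs_add_le _ _).trans (le_of_eq ?_)
    rw [abs_mul, abs_mul (s * b i)]
  have hM0 : -U < a₀ * p + s * b₀ * q := by
    have : |∑ i, (a i * c i - s * b i * d i)| ≤ U :=
      (Finset.abs_sum_le_sum_abs _ _).trans (Finset.sum_le_sum fun i _ => term i)
    linarith [(abs_le.1 this).1]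
  have hMU : U ^ 2 < (a₀ * p + s * b₀ * q) ^ 2 := by
    have e := sq_le_sq' (by linarith [abs_nonneg (s * b₀ * p - a₀ * q), neg_le_neg hVG]) hVG
    rw [sq_abs] at e
    have : (a₀ * p + s * b₀ * q) ^ 2 + (s * b₀ * p - a₀ * q) ^ 2 = a₀ ^ 2 + (s * b₀) ^ 2 := by
      linear_combination (a₀ ^ 2 + (s * b₀) ^ 2) * hpq
    linarith
  -- The squares decide the size, and `hM0` excludes the negative square root.
  have hM : U < a₀ * p + s * b₀ * q := by
    by_contra! hc
    nlinarith
  have hW : |∑ i, η i * (a i * c i - s * b i * d i)| ≤ U := by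
    refine (Finset.abs_sum_le_sum_abs _ _).trans (Finset.sum_le_sum fun i _ => ?_)
    rw [abs_mul]
    exact (mul_le_of_le_one_left (abs_nonneg _) (hη i)).trans (term i)
  have hc1 : ∀ x y : ℝ, x ^ 2 + y ^ 2 = 1 → |x| ≤ 1 := fun x y hxy =>
    abs_le_one_iff_mul_self_le_one.2 (by nlinarith [sq_nonneg y])
  have hX : 0 ≤ s * (b₀ * p - ∑ i, b i * c i) := by
    refine cross_nonneg (a₀ := a₀) (b₀ := s * b₀) (Y := ∑ i, s * b i * c i)
      (Z := ∑ i, a i * d i) ha (by positivity) hκ h hpq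
      (by linarith) ?_ ?_ ?_ ?_
    · calc |∑ i, s * b i * c i| ≤ ∑ i, s * |b i| := by
            refine (Finset.abs_sum_le_sum_abs _ _).trans (Finset.sum_le_sum fun i _ => ?_)
            rw [abs_mul, abs_mul, abs_of_pos hs]
            exact mul_le_of_le_one_right (by positivity) (hc1 _ _ (hcd i))
        _ = μ * (s * b₀) := by rw [← Finset.mul_sum, hB]; ring
    · calc |∑ i, a i * d i| ≤ ∑ i, |a i| := by
            refine (Finset.abs_sum_le_sum_abs _ _).trans (Finset.sum_le_sum fun i _ => ?_)
            rw [abs_mul]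
            exact mul_le_of_le_one_right (by positivity)
              (hc1 _ _ ((add_comm _ _).trans (hcd i)))
        _ = κ * a₀ := hA
    · rw [mul_sub, Finset.mul_sum]
      simp only [mul_assoc]
    · rw [mul_sub, Finset.mul_sum]
      rw [Finset.sum_add_distrib] at hG
      simp only [mul_assoc] at hG ⊢
      linarith
  have hX' := nonneg_of_mul_nonneg_right hX hs
  linarith [(abs_le.1 hW).2]

/-! ### The symbol of a boundary condition -/

namespace EndCondition

/-- The symbol of the boundary condition: for `s > 0` the function `sin (s * x + θ)` satisfies the
condition at `1` iff `exp (i * (s + θ))` times the symbol is real. -/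
def symbol (E : EndCondition) (s : ℝ) : ℂ :=
  (E.α₀ + (s * E.β₀ : ℝ) * Complex.I) -
    ∑ i, (E.α i + (s * E.β i : ℝ) * Complex.I) * Complex.exp (((E.η i - 1) * s : ℝ) * Complex.I)

/-- The symbol, divided by `s` if `α₀ = 0`, so that it does not vanish at `s = 0`. -/
def normSymbol (E : EndCondition) (s : ℝ) : ℂ :=
  if E.α₀ = 0 then
    Complex.I * (E.β₀ - ∑ i, E.β i * Complex.exp (((E.η i - 1) * s : ℝ) * Complex.I))
  else E.symbol s

/-- The phase shift produced by the boundary condition. -/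
def shift (E : EndCondition) (s : ℝ) : ℝ := (E.normSymbol s).arg

variable {E : EndCondition}

theorem Admissible.β₀_nonneg (h : E.Admissible 1) : 0 ≤ E.β₀ := by
  simpa using h.β₀_sign

theorem Admissible.α_eq_zero {ν : ℝ} (h : E.Admissible ν) (h0 : E.α₀ = 0) (i : Fin E.m) :
    E.α i = 0 := by
  have := (Finset.sum_eq_zero_iff_of_nonneg fun j _ => abs_nonneg (E.α j)).1 (h.α_zero h0) i
    (Finset.mem_univ i)
  simpa using this

theorem Admissible.sum_α {ν : ℝ} (h : E.Admissible ν) :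
    ∑ i, |E.α i| = (∑ i, |E.α i|) / E.α₀ * E.α₀ := by
  by_cases h0 : E.α₀ = 0
  · rw [h0, mul_zero, h.α_zero h0]
  · rw [div_mul_cancel₀ _ h0]

theorem Admissible.sum_β {ν : ℝ} (h : E.Admissible ν) :
    ∑ i, |E.β i| = (∑ i, |E.β i|) / E.β₀ * E.β₀ := by
  by_cases h0 : E.β₀ = 0
  · rw [h0, mul_zero, h.β_zero h0]
  · rw [div_mul_cancel₀ _ h0]

theorem Admissible.sum_α_lt {ν : ℝ} (h : E.Admissible ν) (h0 : 0 < E.α₀) :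
    ∑ i, |E.α i| < E.α₀ := by
  have h1 : (∑ i, |E.α i|) / E.α₀ < 1 := by
    nlinarith [h.small, sq_nonneg ((∑ i, |E.β i|) / E.β₀)]
  rwa [div_lt_one h0] at h1

theorem Admissible.sum_β_lt (h : E.Admissible 1) (h0 : 0 < E.β₀) :
    ∑ i, |E.β i| < E.β₀ := by
  have h1 : (∑ i, |E.β i|) / E.β₀ < 1 := by
    nlinarith [h.small, sq_nonneg ((∑ i, |E.α i|) / E.α₀)]
  rwa [div_lt_one h0] at h1

theorem Admissible.β₀_pos (h : E.Admissible 1) (h0 : E.α₀ = 0) : 0 < E.β₀ := by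
  have := h.nontrivial
  rwa [h0, zero_add, abs_of_nonneg h.β₀_nonneg] at this

theorem Admissible.sq_add_pos (h : E.Admissible 1) {s : ℝ} (hs : 0 < s) :
    0 < E.α₀ ^ 2 + (s * E.β₀) ^ 2 := by
  by_cases h0 : E.α₀ = 0
  · have := h.β₀_pos h0
    positivity
  · positivity

theorem norm_sum_exp_le {m : ℕ} (z : Fin m → ℂ) (t : Fin m → ℝ) :
    ‖∑ i, z i * Complex.exp (t i * Complex.I)‖ ≤ ∑ i, ‖z i‖ :=
  norm_sum_le_of_le _ fun i _ => by rw [norm_mul, Complex.norm_exp_ofReal_mul_I, mul_one]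

theorem norm_coeff_le (a b : ℝ) {s : ℝ} (hs : 0 ≤ s) :
    ‖(a + (s * b : ℝ) * Complex.I : ℂ)‖ ≤ |a| + s * |b| := by
  refine (norm_add_le _ _).trans (le_of_eq ?_)
  simp [abs_of_nonneg hs]

/-- Were the symbol real and nonpositive, w would have the imaginary part of α₀ + isβ₀ and a real
part at least α₀ ≥ 0, contradicting |w| < |α₀ + isβ₀|. -/
theorem Admissible.symbol_mem_slitPlane (h : E.Admissible 1) {s : ℝ} (hs : 0 ≤ s)
    (h0 : 0 < E.α₀ ^ 2 + (s * E.β₀) ^ 2) : E.symbol s ∈ Complex.slitPlane := by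
  set w := ∑ i, (E.α i + (s * E.β i : ℝ) * Complex.I) *
    Complex.exp (((E.η i - 1) * s : ℝ) * Complex.I) with hw
  have hw1 : ‖w‖ ≤ ∑ i, |E.α i| + s * ∑ i, |E.β i| := by
    refine (norm_sum_exp_le _ _).trans ?_
    rw [Finset.mul_sum, ← Finset.sum_add_distrib]
    exact Finset.sum_le_sum fun i _ => norm_coeff_le _ _ hs
  have hw2 : ‖w‖ ^ 2 < E.α₀ ^ 2 + (s * E.β₀) ^ 2 := by
    refine (pow_le_pow_left₀ (norm_nonneg _) hw1 2).trans_lt ?_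
    have := sq_add_lt_of_small h.small h0
    have e : ∑ i, |E.α i| + s * ∑ i, |E.β i| =
        (∑ i, |E.α i|) / E.α₀ * E.α₀ + (∑ i, |E.β i|) / E.β₀ * (s * E.β₀) := by
      linear_combination h.sum_α + s * h.sum_β
    rwa [e]
  rw [Complex.sq_norm, Complex.normSq_apply] at hw2
  have hre : (E.symbol s).re = E.α₀ - w.re := by simp [symbol, hw]
  have him : (E.symbol s).im = s * E.β₀ - w.im := by simp [symbol, hw]
  rw [Complex.mem_slitPlane_iff, hre, him]
  by_contra! hc
  rw [sub_eq_zero.1 hc.2] at hw2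
  nlinarith [h.α₀_nonneg, hc.1]

theorem symbol_eq_mul_normSymbol (h : E.Admissible 1) (h0 : E.α₀ = 0) (s : ℝ) :
    E.symbol s = (s : ℂ) * E.normSymbol s := by
  rw [normSymbol, if_pos h0, symbol, h0]
  simp only [h.α_eq_zero h0]
  simp only [mul_sub, Finset.mul_sum]
  push_cast
  congr 1
  · ring
  · exact Finset.sum_congr rfl fun i _ => by ring

theorem arg_symbol (h : E.Admissible 1) {s : ℝ} (hs : 0 < s) :
    (E.symbol s).arg = E.shift s := by
  by_cases h0 : E.α₀ = 0
  · rw [symbol_eq_mul_normSymbol h h0, Complex.arg_real_mul _ hs, shift]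
  · rw [shift, normSymbol, if_neg h0]

theorem Admissible.normSymbol_mem_slitPlane (h : E.Admissible 1) {s : ℝ} (hs : 0 ≤ s) :
    E.normSymbol s ∈ Complex.slitPlane := by
  by_cases h0 : E.α₀ = 0
  · rw [normSymbol, if_pos h0]
    set w := ∑ i, (E.β i : ℂ) * Complex.exp (((E.η i - 1) * s : ℝ) * Complex.I) with hw
    have hw1 : ‖w‖ ≤ ∑ i, |E.β i| := by
      refine (norm_sum_exp_le _ _).trans (le_of_eq ?_)
      simp
    refine Complex.mem_slitPlane_iff.2 (Or.inr (ne_of_gt ?_))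
    have := h.sum_β_lt (h.β₀_pos h0)
    have := (Complex.abs_re_le_norm w).trans hw1
    simp
    linarith [le_abs_self w.re]
  · rw [normSymbol, if_neg h0]
    refine h.symbol_mem_slitPlane hs ?_
    positivity

theorem continuous_symbol (E : EndCondition) : Continuous E.symbol := by
  unfold symbol
  fun_prop

theorem continuous_normSymbol (E : EndCondition) : Continuous E.normSymbol := by
  unfold normSymbol
  split_ifs
  · fun_prop
  · exact E.continuous_symbol

theorem Admissible.continuousOn_shift (h : E.Admissible 1) : ContinuousOn E.shift (Ici 0) :=
  fun _ hs => ((Complex.continuousAt_arg (h.normSymbol_mem_slitPlane hs)).comp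
    E.continuous_normSymbol.continuousAt).continuousWithinAt

/-- All exponentials are 1 at s = 0, so `normSymbol` is a positive multiple of i or of 1. -/
theorem Admissible.shift_zero (h : E.Admissible 1) :
    E.shift 0 = if E.α₀ = 0 then Real.pi / 2 else 0 := by
  unfold shift normSymbol
  split_ifs with h0
  · have e : Complex.I * (E.β₀ - ∑ i, (E.β i : ℂ) *
        Complex.exp (((E.η i - 1) * 0 : ℝ) * Complex.I)) =
        ((E.β₀ - ∑ i, E.β i : ℝ) : ℂ) * Complex.I := by
      simp [mul_comm]
    have h1 : ∑ i, E.β i ≤ ∑ i, |E.β i| := Finset.sum_le_sum fun i _ => le_abs_self _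
    rw [e, Complex.arg_real_mul _ (by linarith [h.sum_β_lt (h.β₀_pos h0)]), Complex.arg_I]
  · have e : E.symbol 0 = ((E.α₀ - ∑ i, E.α i : ℝ) : ℂ) := by simp [symbol]
    have h1 : ∑ i, E.α i ≤ ∑ i, |E.α i| := Finset.sum_le_sum fun i _ => le_abs_self _
    rw [e, Complex.arg_ofReal_of_nonneg]
    linarith [h.sum_α_lt (h.α₀_nonneg.lt_of_ne' h0)]

theorem hasDerivAt_symbol (E : EndCondition) (s : ℝ) :
    HasDerivAt E.symbol (((E.β₀ : ℝ) * Complex.I) -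
      ∑ i, ((E.β i : ℝ) * Complex.I * Complex.exp (((E.η i - 1) * s : ℝ) * Complex.I) +
        (E.α i + (s * E.β i : ℝ) * Complex.I) * (Complex.exp (((E.η i - 1) * s : ℝ) * Complex.I) *
          ((E.η i - 1 : ℝ) * Complex.I)))) s := by
  have hid : ∀ c : ℝ, HasDerivAt (fun s : ℝ => ((s * c : ℝ) : ℂ) * Complex.I)
      ((c : ℂ) * Complex.I) s := fun c => by
    have := (((hasDerivAt_id s).mul_const c).ofReal_comp).mul_const Complex.I
    simpa using this
  unfold symbol
  refine ((hid E.β₀).const_add _).sub (HasDerivAt.fun_sum fun i _ => ?_)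
  refine ((hid (E.β i)).const_add _).mul ?_
  simpa only [mul_comm _ (E.η i - 1)] using (hid (E.η i - 1)).cexp

/-- The total phase `s + shift s` is strictly increasing. -/
theorem Admissible.hasDerivAt_shift (h : E.Admissible 1) {s : ℝ} (hs : 0 < s) :
    ∃ d : ℝ, HasDerivAt E.shift d s ∧ 0 < 1 + d := by
  have hslit := h.symbol_mem_slitPlane hs.le (h.sq_add_pos hs)
  have hne : E.symbol s ≠ 0 := Complex.slitPlane_ne_zero hslit
  have hd := E.hasDerivAt_symbol s
  set y' := ((E.β₀ : ℝ) * Complex.I : ℂ) -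
      ∑ i, ((E.β i : ℝ) * Complex.I * Complex.exp (((E.η i - 1) * s : ℝ) * Complex.I) +
        (E.α i + (s * E.β i : ℝ) * Complex.I) * (Complex.exp (((E.η i - 1) * s : ℝ) * Complex.I) *
          ((E.η i - 1 : ℝ) * Complex.I))) with hy'
  -- The argument is the imaginary part of the logarithm, so its derivative is that of the
  -- logarithmic derivative.
  refine ⟨(y' / E.symbol s).im, ?_, ?_⟩
  · have h1 : HasDerivAt (fun t => (Complex.log (E.symbol t)).im) (y' / E.symbol s).im s :=
      Complex.imCLM.hasFDerivAt.comp_hasDerivAt s (hd.clog_real hslit)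
    refine h1.congr_of_eventuallyEq ?_
    filter_upwards [Ioi_mem_nhds hs] with t ht
    rw [Complex.log_im, arg_symbol h ht]
  · set g := (E.symbol s).arg with hg
    have hpolar : E.symbol s = (‖E.symbol s‖ : ℂ) * Complex.exp (g * Complex.I) :=
      (Complex.norm_mul_exp_arg_mul_I _).symm
    have hr : 0 < ‖E.symbol s‖ := norm_pos_iff.2 hne
    set r := ‖E.symbol s‖ with hr_def
    have hexp : Complex.exp (g * Complex.I) * Complex.exp ((-g : ℝ) * Complex.I) = 1 := by
      rw [← Complex.exp_add]
      simp
    -- Rotating by -g makes the denominator real, so only the imaginary part of the rotated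
    -- derivative has to be compared with -r.
    have hrot : E.symbol s * Complex.exp ((-g : ℝ) * Complex.I) = r := by
      rw [hpolar, mul_assoc, hexp, mul_one]
    have hquot : y' / E.symbol s = y' * Complex.exp ((-g : ℝ) * Complex.I) / r := by
      rw [← hrot, mul_div_mul_right _ _ (Complex.exp_ne_zero _)]
    have hadd : ∀ i, Complex.exp (((E.η i - 1) * s : ℝ) * Complex.I) *
        Complex.exp ((-g : ℝ) * Complex.I) =
        Complex.exp (((E.η i - 1) * s - g : ℝ) * Complex.I) := fun i => by
      rw [← Complex.exp_add]
      congr 1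
      push_cast
      ring
    have e1 : E.symbol s * Complex.exp ((-g : ℝ) * Complex.I) =
        (E.α₀ + (s * E.β₀ : ℝ) * Complex.I) * Complex.exp ((-g : ℝ) * Complex.I) -
        ∑ i, (E.α i + (s * E.β i : ℝ) * Complex.I) *
          Complex.exp (((E.η i - 1) * s - g : ℝ) * Complex.I) := by
      rw [symbol, sub_mul, Finset.sum_mul]
      simp only [mul_assoc, hadd]
    have e2 : y' * Complex.exp ((-g : ℝ) * Complex.I) =
        ((E.β₀ : ℝ) * Complex.I : ℂ) * Complex.exp ((-g : ℝ) * Complex.I) -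
        ∑ i, ((E.β i : ℝ) * Complex.I + (E.α i + (s * E.β i : ℝ) * Complex.I) *
          ((E.η i - 1 : ℝ) * Complex.I)) *
          Complex.exp (((E.η i - 1) * s - g : ℝ) * Complex.I) := by
      rw [hy', sub_mul, Finset.sum_mul]
      congr 1
      refine Finset.sum_congr rfl fun i _ => ?_
      rw [← hadd]
      ring
    have hre := congrArg Complex.re (e1.symm.trans hrot)
    have him := congrArg Complex.im (e1.symm.trans hrot)
    have him' := congrArg Complex.im e2
    have h2 : 1 + (y' / E.symbol s).im =
        (r + (y' * Complex.exp ((-g : ℝ) * Complex.I)).im) / r := by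
      rw [hquot, Complex.div_ofReal_im]
      field_simp
    rw [h2, him']
    refine div_pos ?_ hr
    simp only [Complex.sub_re, Complex.sub_im, Complex.re_sum, Complex.im_sum, Complex.mul_re,
      Complex.mul_im, Complex.add_re, Complex.add_im, Complex.ofReal_re, Complex.ofReal_im,
      Complex.I_re, Complex.I_im, Complex.exp_ofReal_mul_I_re, Complex.exp_ofReal_mul_I_im,
      Real.cos_neg, Real.sin_neg] at hre him ⊢
    have main := phase_ineq (a₀ := E.α₀) (b₀ := E.β₀) (s := s) (p := Real.cos g) (q := Real.sin g)
      (a := E.α) (b := E.β) (η := E.η) (c := fun i => Real.cos ((E.η i - 1) * s - g))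
      (d := fun i => Real.sin ((E.η i - 1) * s - g))
      h.α₀_nonneg h.β₀_nonneg hs
      (div_nonneg (Finset.sum_nonneg fun i _ => abs_nonneg _) h.α₀_nonneg)
      h.small
      (h.sq_add_pos hs) h.sum_α h.sum_β (fun i => abs_le.2 (h.η_mem i))
      (Real.cos_sq_add_sin_sq _) (fun i => Real.cos_sq_add_sin_sq _) ?_ ?_
    · refine main.trans_eq ?_
      rw [← hre]
      have : ∀ x y u v w z x' : ℝ, x = x' → u + v = w + z → x - u + (y - v) = x' - w + (y - z) := by
        intros
        linarith
      trans (E.α₀ * Real.cos g + s * E.β₀ * Real.sin g -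
        ∑ i, (E.α i * Real.cos ((E.η i - 1) * s - g) -
          s * E.β i * Real.sin ((E.η i - 1) * s - g))) + (E.β₀ * Real.cos g -
        ∑ i, (E.β i * Real.cos ((E.η i - 1) * s - g) + (E.η i - 1) *
          (E.α i * Real.cos ((E.η i - 1) * s - g) -
          s * E.β i * Real.sin ((E.η i - 1) * s - g))))
      · refine this _ _ _ _ _ _ _ rfl ?_
        rw [← Finset.sum_add_distrib, ← Finset.sum_add_distrib]
        exact Finset.sum_congr rfl fun i _ => by ring
      · congr 2
        · ring
        · exact Finset.sum_congr rfl fun i _ => by ring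
        · ring
        · exact Finset.sum_congr rfl fun i _ => by ring
    · rw [← sub_eq_zero, ← him]
      have : ∀ x y z w : ℝ, x = z → y = w → x - y = z - w := by rintro _ _ _ _ rfl rfl; rfl
      refine this _ _ _ _ (by ring) (Finset.sum_congr rfl fun i _ => by ring)
    · refine hr.trans_le (le_of_eq ?_)
      rw [← hre]
      have : ∀ x y z w : ℝ, x = z → y = w → x - y = z - w := by rintro _ _ _ _ rfl rfl; rfl
      refine this _ _ _ _ (by ring) (Finset.sum_congr rfl fun i _ => by ring)

end EndCondition

/-! ### Boundary conditions for a pair of functions -/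

namespace EndCondition

variable {E : EndCondition}

/-- The boundary condition `E` at `ν` for a function with values `v` and derivative `w`. -/
def Balanced (E : EndCondition) (ν : ℝ) (v w : ℝ → ℝ) : Prop :=
  E.α₀ * v ν + E.β₀ * w ν = ∑ i, E.α i * v (E.η i) + ∑ i, E.β i * w (E.η i)

theorem Balanced.congr {ν : ℝ} {v w v' w' : ℝ → ℝ} (h : E.Balanced ν v w) (hη : ∀ i, E.η i ∈ I)
    (hν : ν ∈ I) (hv : ∀ x ∈ I, v x = v' x) (hw : ∀ x ∈ I, w x = w' x) : E.Balanced ν v' w' := by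
  unfold Balanced at *
  rw [← hv _ hν, ← hw _ hν, h]
  congr 1
  · exact Finset.sum_congr rfl fun i _ => by rw [hv _ (hη i)]
  · exact Finset.sum_congr rfl fun i _ => by rw [hw _ (hη i)]

theorem balanced_const_mul {ν c : ℝ} (hc : c ≠ 0) {v w : ℝ → ℝ} :
    E.Balanced ν (fun x => c * v x) (fun x => c * w x) ↔ E.Balanced ν v w := by
  unfold Balanced
  simp only [mul_left_comm _ c, ← Finset.mul_sum, ← mul_add, mul_right_inj' hc]

/-- The boundary condition transformed by `x ↦ -x`. -/
def reflect (E : EndCondition) : EndCondition :=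
  ⟨E.m, E.α₀, -E.β₀, E.α, fun i => -E.β i, fun i => -E.η i⟩

theorem balanced_reflect {ν : ℝ} {v w : ℝ → ℝ} :
    E.reflect.Balanced (-ν) (fun x => v (-x)) (fun x => -w (-x)) ↔ E.Balanced ν v w := by
  simp [Balanced, reflect]
  rfl

theorem Admissible.reflect {ν : ℝ} (h : E.Admissible ν) : E.reflect.Admissible (-ν) where
  one_le_m := h.one_le_m
  η_mem i := ⟨neg_le_neg (h.η_mem i).2, neg_le.2 (h.η_mem i).1⟩
  η_ne i := fun hi => h.η_ne i (neg_injective hi)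
  α₀_nonneg := h.α₀_nonneg
  nontrivial := by simpa [EndCondition.reflect] using h.nontrivial
  β₀_sign := by simpa [EndCondition.reflect] using h.β₀_sign
  α_zero := h.α_zero
  β_zero h0 := by
    simp only [EndCondition.reflect, abs_neg]
    exact h.β_zero (neg_eq_zero.1 h0)
  small := by
    simp only [EndCondition.reflect, abs_neg, div_neg, neg_sq]
    exact h.small

/-- If `|v|` and `|w|` both attain their maximum at `1`, the boundary condition is degenerate. -/
theorem Admissible.eq_zero_of_max (h : E.Admissible 1) {v w : ℝ → ℝ} (hb : E.Balanced 1 v w)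
    (hv0 : 0 < v 1) (hw0 : 0 ≤ w 1) (hv : ∀ x ∈ I, |v x| ≤ v 1) (hw : ∀ x ∈ I, |w x| ≤ w 1) :
    E.α₀ = 0 ∧ w 1 = 0 := by
  have bound : ∀ (a : Fin E.m → ℝ) (f : ℝ → ℝ), (∀ x ∈ I, |f x| ≤ f 1) →
      ∑ i, a i * f (E.η i) ≤ (∑ i, |a i|) * f 1 := by
    intro a f hf
    rw [Finset.sum_mul]
    refine Finset.sum_le_sum fun i _ => (le_abs_self _).trans ?_
    rw [abs_mul]
    exact mul_le_mul_of_nonneg_left (hf _ (h.η_mem i)) (abs_nonneg _)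
  have h1 := bound E.α v hv
  have h2 := bound E.β w hw
  have h3 : E.α₀ * v 1 + E.β₀ * w 1 ≤ (∑ i, |E.α i|) * v 1 + (∑ i, |E.β i|) * w 1 :=
    hb.le.trans (add_le_add h1 h2)
  rcases h.α₀_nonneg.eq_or_lt with h0 | h0
  · refine ⟨h0.symm, le_antisymm ?_ hw0⟩
    rw [h.α_zero h0.symm, ← h0] at h3
    by_contra! hc
    nlinarith [h.sum_β_lt (h.β₀_pos h0.symm)]
  · exfalso
    have h4 : ∑ i, |E.β i| ≤ E.β₀ := by
      rcases h.β₀_nonneg.eq_or_lt with hb0 | hb0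
      · rw [h.β_zero hb0.symm, ← hb0]
      · exact (h.sum_β_lt hb0).le
    nlinarith [mul_lt_mul_of_pos_right (h.sum_α_lt h0) hv0, mul_le_mul_of_nonneg_right h4 hw0]

/-- The defect in the boundary condition is Im(e^{iφ} · symbol) = |symbol| sin(φ + shift). -/
theorem Admissible.balanced_sine (h : E.Admissible 1) {s : ℝ} (hs : 0 < s) (φ : ℝ) :
    E.Balanced 1 (fun x => Real.sin (s * (x - 1) + φ)) (fun x => s * Real.cos (s * (x - 1) + φ)) ↔
      Real.sin (φ + E.shift s) = 0 := by
  have hne : E.symbol s ≠ 0 :=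
    Complex.slitPlane_ne_zero (h.symbol_mem_slitPlane hs.le (h.sq_add_pos hs))
  obtain ⟨r, hr⟩ : ∃ r, r = ‖E.symbol s‖ := ⟨_, rfl⟩
  have e1 : E.symbol s * Complex.exp (φ * Complex.I) =
      r * Complex.exp ((φ + E.shift s : ℝ) * Complex.I) := by
    conv_lhs => rw [← Complex.norm_mul_exp_arg_mul_I (E.symbol s)]
    rw [arg_symbol h hs, ← hr, mul_assoc, ← Complex.exp_add]
    congr 2
    push_cast
    ring
  have hadd : ∀ i, Complex.exp (((E.η i - 1) * s : ℝ) * Complex.I) *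
      Complex.exp (φ * Complex.I) =
      Complex.exp ((s * (E.η i - 1) + φ : ℝ) * Complex.I) := fun i => by
    rw [← Complex.exp_add]
    congr 1
    push_cast
    ring
  rw [symbol, sub_mul, Finset.sum_mul] at e1
  simp only [mul_assoc, hadd] at e1
  have him := (congrArg Complex.im e1).trans (show _ = r * Real.sin (φ + E.shift s) by
    rw [Complex.im_ofReal_mul, Complex.exp_ofReal_mul_I_im])
  simp only [Complex.sub_im, Complex.im_sum, Complex.mul_re,
    Complex.mul_im, Complex.add_re, Complex.add_im, Complex.ofReal_re, Complex.ofReal_im,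
    Complex.I_re, Complex.I_im, Complex.exp_ofReal_mul_I_re, Complex.exp_ofReal_mul_I_im] at him
  rw [← mul_eq_zero_iff_left (hr ▸ norm_ne_zero_iff.2 hne), ← him, Balanced, ← sub_eq_zero,
    ← Finset.sum_add_distrib]
  have : ∀ a b c d e : ℝ, a + b = d → c = e → (a + b - c = 0 ↔ d - e = 0) := by
    rintro _ _ _ _ _ rfl rfl
    rfl
  refine this _ _ _ _ _ ?_ ?_
  · simp only [sub_self, mul_zero, zero_add]
    ring
  · exact Finset.sum_congr rfl fun i _ => by ring

/-- Under x ↦ -x the sine becomes minus a sine whose phase at 1 is 2s - φ. -/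
theorem Admissible.balanced_sine_left (h : E.Admissible (-1)) {s : ℝ} (hs : 0 < s) (φ : ℝ) :
    E.Balanced (-1) (fun x => Real.sin (s * (x - 1) + φ))
      (fun x => s * Real.cos (s * (x - 1) + φ)) ↔
      Real.sin (2 * s - φ + E.reflect.shift s) = 0 := by
  have hr := h.reflect
  rw [neg_neg] at hr
  rw [← hr.balanced_sine hs, ← balanced_reflect, neg_neg,
    ← balanced_const_mul (neg_ne_zero.2 (one_ne_zero (α := ℝ)))]
  have e : ∀ x : ℝ, s * (-x - 1) + φ = -(s * (x - 1) + (2 * s - φ)) := fun x => by ring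
  simp only [e, Real.sin_neg, Real.cos_neg, neg_mul, one_mul, neg_neg]

end EndCondition

/-! ### Solutions of the differential equation -/

theorem D1_eq {v w : ℝ → ℝ} (hv : ∀ x, HasDerivAt v (w x) x) {x : ℝ} (hx : x ∈ I) :
    D1 v x = w x :=
  (hv x).hasDerivWithinAt.derivWithin (uniqueDiffOn_Icc (by norm_num) x hx)

theorem D2_eq {v w z : ℝ → ℝ} (hv : ∀ x, HasDerivAt v (w x) x) (hw : ∀ x, HasDerivAt w (z x) x)
    {x : ℝ} (hx : x ∈ I) : D2 v x = z x := by
  unfold D2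
  rw [derivWithin_congr (fun y hy => D1_eq hv hy) (D1_eq hv hx)]
  exact D1_eq hw hx

theorem hasDerivWithinAt_D1 {u : ℝ → ℝ} (hu : ContDiffOn ℝ 2 u I) {x : ℝ} (hx : x ∈ I) :
    HasDerivWithinAt u (D1 u x) I x :=
  ((hu.differentiableOn (by norm_num)) x hx).hasDerivWithinAt

theorem contDiffOn_D1 {u : ℝ → ℝ} (hu : ContDiffOn ℝ 2 u I) : ContDiffOn ℝ 1 (D1 u) I :=
  hu.derivWithin (uniqueDiffOn_Icc (by norm_num)) (by norm_num)

theorem hasDerivWithinAt_D2 {u : ℝ → ℝ} (hu : ContDiffOn ℝ 2 u I) {x : ℝ} (hx : x ∈ I) :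
    HasDerivWithinAt (D1 u) (D2 u x) I x :=
  (((contDiffOn_D1 hu).differentiableOn (by norm_num)) x hx).hasDerivWithinAt

namespace Problem

variable {P : Problem}

theorem IsEigenfunction.D2_eq {lam : ℝ} {u : ℝ → ℝ} (h : P.IsEigenfunction lam u) {x : ℝ}
    (hx : x ∈ I) : D2 u x = -(lam * u x) := by
  have hc : ContinuousOn (D2 u) I :=
    (contDiffOn_D1 h.contDiffOn).continuousOn_derivWithin (uniqueDiffOn_Icc (by norm_num))
      (by norm_num)
  -- The equation is given on the open interval only; continuity of u'' carries it to the end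
  -- points.
  have he : EqOn (D2 u) (fun x => -(lam * u x)) (Ioo (-1) 1) := fun y hy => by
    have := h.ode y hy
    simp only
    linarith
  refine he.of_subset_closure hc (continuousOn_const.mul h.contDiffOn.continuousOn).neg
    Ioo_subset_Icc_self ?_ hx
  rw [closure_Ioo (by norm_num)]

/-- Both uC - u'S and λuS + u'C have zero derivative; `hCS` inverts this linear system for u and u'.
-/
theorem IsEigenfunction.exists_rep {lam : ℝ} {u : ℝ → ℝ} (h : P.IsEigenfunction lam u)
    {C S : ℝ → ℝ} (hC : ∀ x, HasDerivAt C (-(lam * S x)) x) (hS : ∀ x, HasDerivAt S (C x) x)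
    (hCS : ∀ x, C x ^ 2 + lam * S x ^ 2 = 1) :
    ∃ A B : ℝ, (A ≠ 0 ∨ B ≠ 0) ∧ ∀ x ∈ I, u x = A * C x + B * S x ∧
      D1 u x = -lam * A * S x + B * C x := by
  have hu : ∀ x ∈ I, HasDerivWithinAt u (D1 u x) I x := fun x => hasDerivWithinAt_D1 h.contDiffOn
  have hu' : ∀ x ∈ I, HasDerivWithinAt (D1 u) (-(lam * u x)) I x := fun x hx =>
    h.D2_eq hx ▸ hasDerivWithinAt_D2 h.contDiffOn hx
  have hconst : ∀ f : ℝ → ℝ, (∀ x ∈ I, HasDerivWithinAt f 0 I x) → ∀ x ∈ I, f x = f (-1) :=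
    fun f hf => constant_of_derivWithin_zero (fun x hx => (hf x hx).differentiableWithinAt)
      fun x hx => (hf x (Ico_subset_Icc_self hx)).derivWithin
        (uniqueDiffOn_Icc (by norm_num) x (Ico_subset_Icc_self hx))
  have hA := hconst (fun x => u x * C x - D1 u x * S x) fun x hx => by
    refine (((hu x hx).mul (hC x).hasDerivWithinAt).sub
      ((hu' x hx).mul (hS x).hasDerivWithinAt)).congr_deriv ?_
    ring
  have hB := hconst (fun x => lam * u x * S x + D1 u x * C x) fun x hx => by
    refine ((((hu x hx).const_mul lam).mul (hS x).hasDerivWithinAt).add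
      ((hu' x hx).mul (hC x).hasDerivWithinAt)).congr_deriv ?_
    ring
  set A := u (-1) * C (-1) - D1 u (-1) * S (-1)
  set B := lam * u (-1) * S (-1) + D1 u (-1) * C (-1)
  have hrep : ∀ x ∈ I, u x = A * C x + B * S x ∧ D1 u x = -lam * A * S x + B * C x := by
    intro x hx
    have a := hA x hx
    have b := hB x hx
    rw [← a, ← b]
    constructor
    · linear_combination (-u x) * hCS x
    · linear_combination (-D1 u x) * hCS x
  refine ⟨A, B, ?_, hrep⟩
  by_contra! hc
  obtain ⟨x, hx, hne⟩ := h.nontrivial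
  exact hne (by rw [(hrep x hx).1, hc.1, hc.2]; ring)

theorem isEigenfunction_of_hasDerivAt {lam : ℝ} {v w : ℝ → ℝ} (hv : ∀ x, HasDerivAt v (w x) x)
    (hw : ∀ x, HasDerivAt w (-(lam * v x)) x) (hc : ContDiff ℝ 2 v) (hP : P.Admissible)
    (hl : P.left.Balanced (-1) v w) (hr : P.right.Balanced 1 v w) (hne : ∃ x ∈ I, v x ≠ 0) :
    P.IsEigenfunction lam v where
  contDiffOn := hc.contDiffOn
  bc_left := hl.congr hP.left.η_mem (by norm_num) (fun _ _ => rfl) fun _ hx => (D1_eq hv hx).symm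
  bc_right := hr.congr hP.right.η_mem (by norm_num) (fun _ _ => rfl) fun _ hx => (D1_eq hv hx).symm
  ode x hx := by rw [MultiPoint.D2_eq hv hw (Ioo_subset_Icc_self hx), neg_neg]
  nontrivial := hne

end Problem

/-- Fundamental solutions for `lam ≤ 0`. -/
theorem exists_fundamental_of_nonpos {lam : ℝ} (hl : lam ≤ 0) : ∃ C S : ℝ → ℝ,
    (∀ x, HasDerivAt C (-(lam * S x)) x) ∧ (∀ x, HasDerivAt S (C x) x) ∧
    (∀ x, C x ^ 2 + lam * S x ^ 2 = 1) ∧ (∀ x, C (-x) = C x) ∧ (∀ x, S (-x) = -S x) ∧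
    (∀ x ∈ I, |C x| ≤ C 1) ∧ (∀ x ∈ I, |S x| ≤ S 1) ∧ 0 < C 1 ∧ 0 < S 1 ∧
    (lam = 0 → ∀ x, C x = 1) := by
  rcases hl.eq_or_lt with rfl | hl
  · refine ⟨fun _ => 1, fun x => x, fun x => ?_, fun x => hasDerivAt_id x, ?_⟩
    · simpa using hasDerivAt_const x (1 : ℝ)
    · simp [abs_le]
  · obtain ⟨s, hs, rfl⟩ : ∃ s : ℝ, 0 < s ∧ lam = -s ^ 2 :=
      ⟨√(-lam), Real.sqrt_pos.2 (by linarith), by rw [Real.sq_sqrt (by linarith)]; ring⟩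
    have hd : ∀ x, HasDerivAt (fun x : ℝ => s * x) s x := fun x => by
      simpa using (hasDerivAt_id x).const_mul s
    refine ⟨fun x => Real.cosh (s * x), fun x => Real.sinh (s * x) / s, fun x => ?_, fun x => ?_,
      fun x => ?_, fun x => by simp, fun x => by simp [neg_div], fun x hx => ?_, fun x hx => ?_,
      Real.cosh_pos _, ?_, fun h0 => ?_⟩
    · refine (hd x).cosh.congr_deriv ?_
      field_simp
    · refine ((hd x).sinh.div_const s).congr_deriv ?_
      field_simp
    · have := Real.cosh_sq (s * x)
      field_simp
      linarith
    · simp only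
      rw [abs_of_pos (Real.cosh_pos _), Real.cosh_le_cosh, abs_mul, abs_mul, abs_one]
      exact mul_le_mul_of_nonneg_left (abs_le.2 hx) (abs_nonneg _)
    · simp only
      rw [abs_div, abs_of_pos hs, Real.abs_sinh, abs_mul, abs_of_pos hs]
      have : s * |x| ≤ s * 1 := mul_le_mul_of_nonneg_left (abs_le.2 hx) hs.le
      gcongr
      exact Real.sinh_le_sinh.2 this
    · exact div_pos (Real.sinh_pos_iff.2 (by linarith)) hs
    · exact absurd h0 (by nlinarith)

/-- If A and B have the same sign, so do -λA and B, hence |v| and |v'| are both largest at 1 and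
`eq_zero_of_max` applies. -/
theorem EndCondition.Admissible.degenerate_of_nonpos {E : EndCondition} (h : E.Admissible 1)
    {lam A B : ℝ} (hl : lam ≤ 0) {C S : ℝ → ℝ} (hC : ∀ x ∈ I, |C x| ≤ C 1)
    (hS : ∀ x ∈ I, |S x| ≤ S 1) (hC1 : 0 < C 1) (hS1 : 0 < S 1) (hAB : 0 ≤ A * B)
    (hne : A ≠ 0 ∨ B ≠ 0)
    (hb : E.Balanced 1 (fun x => A * C x + B * S x) (fun x => -lam * A * S x + B * C x)) :
    lam = 0 ∧ B = 0 ∧ E.α₀ = 0 := by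
  wlog hpos : 0 ≤ A ∧ 0 ≤ B generalizing A B
  · have := this (A := -A) (B := -B) (by linarith) (by simpa using hne) (by
      rw [← EndCondition.balanced_const_mul (neg_ne_zero.2 (one_ne_zero (α := ℝ)))] at hb
      convert hb using 2 <;> ring) (by
      rcases mul_nonneg_iff.1 hAB with h' | h'
      · exact absurd h' hpos
      · exact ⟨by linarith [h'.1], by linarith [h'.2]⟩)
    exact ⟨this.1, neg_eq_zero.1 this.2.1, this.2.2⟩
  obtain ⟨hA, hB⟩ := hpos
  have hlA : 0 ≤ -lam * A := mul_nonneg (by linarith) hA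
  have hbd : ∀ a b x, 0 ≤ a → 0 ≤ b → x ∈ I → |a * C x + b * S x| ≤ a * C 1 + b * S 1 := by
    intro a b x ha hb hx
    refine (abs_add_le _ _).trans ?_
    rw [abs_mul, abs_mul, abs_of_nonneg ha, abs_of_nonneg hb]
    exact add_le_add (mul_le_mul_of_nonneg_left (hC x hx) ha)
      (mul_le_mul_of_nonneg_left (hS x hx) hb)
  have hv : 0 < A * C 1 + B * S 1 := by
    rcases hne with hne | hne
    · exact add_pos_of_pos_of_nonneg (mul_pos (hA.lt_of_ne' hne) hC1) (mul_nonneg hB hS1.le)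
    · exact add_pos_of_nonneg_of_pos (mul_nonneg hA hC1.le) (mul_pos (hB.lt_of_ne' hne) hS1)
  obtain ⟨h0, hw⟩ := h.eq_zero_of_max hb hv (by positivity) (fun x hx => hbd A B x hA hB hx)
    (fun x hx => by
      have := hbd B (-lam * A) x hB hlA hx
      rwa [add_comm, add_comm (B * C 1)] at this)
  have h1 := mul_nonneg hlA hS1.le
  have h2 := mul_nonneg hB hC1.le
  have hB0 : B = 0 := by
    rcases mul_eq_zero.1 (show B * C 1 = 0 by linarith) with h | h
    · exact h
    · exact absurd h hC1.ne'
  have hl0 : -lam * A = 0 := by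
    rcases mul_eq_zero.1 (show -lam * A * S 1 = 0 by linarith) with h | h
    · exact h
    · exact absurd h hS1.ne'
  refine ⟨?_, hB0, h0⟩
  rcases mul_eq_zero.1 hl0 with h | h
  · linarith
  · exact absurd hB0 (hne.resolve_left (not_not.2 h))

namespace Problem

variable {P : Problem}

/-- There are no negative eigenvalues, and `0` is an eigenvalue only in the Neumann-type case. -/
theorem IsEigenfunction.of_nonpos (hP : P.Admissible) {lam : ℝ} (hl : lam ≤ 0) {u : ℝ → ℝ}
    (h : P.IsEigenfunction lam u) : lam = 0 ∧ P.left.α₀ = 0 ∧ P.right.α₀ = 0 ∧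
      ∃ c ≠ 0, ∀ x ∈ I, u x = c ∧ D1 u x = 0 := by
  obtain ⟨C, S, hC, hS, hCS, hCe, hSo, hCb, hSb, hC1, hS1, hC0⟩ := exists_fundamental_of_nonpos hl
  obtain ⟨A, B, hne, hrep⟩ := h.exists_rep hC hS hCS
  have hr : P.right.Balanced 1 (fun x => A * C x + B * S x) (fun x => -lam * A * S x + B * C x) :=
    EndCondition.Balanced.congr h.bc_right hP.right.η_mem (by norm_num) (fun x hx => (hrep x hx).1)
      (fun x hx => (hrep x hx).2)
  have hlft : P.left.Balanced (-1) (fun x => A * C x + B * S x)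
      (fun x => -lam * A * S x + B * C x) :=
    EndCondition.Balanced.congr h.bc_left hP.left.η_mem (by norm_num) (fun x hx => (hrep x hx).1)
      (fun x hx => (hrep x hx).2)
  have hlr : P.left.reflect.Balanced 1 (fun x => A * C x + (-B) * S x)
      (fun x => -lam * A * S x + (-B) * C x) := by
    rw [← EndCondition.balanced_reflect, neg_neg] at hlft
    convert hlft using 2
    · rw [hCe, hSo]
      ring
    · rw [hCe, hSo]
      ring
  have hPl : P.left.reflect.Admissible 1 := by simpa using hP.left.reflect
  have right := fun hAB => hP.right.degenerate_of_nonpos hl hCb hSb hC1 hS1 hAB hne hr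
  have left := fun hAB => hPl.degenerate_of_nonpos (A := A) (B := -B) hl hCb hSb hC1 hS1 hAB
    (by simpa using hne) hlr
  -- The sign of AB selects the end where the maximum sits. That end yields B = 0, so AB = 0 and the
  -- other end applies as well.
  obtain ⟨hl0, hB0, ha, ha'⟩ : lam = 0 ∧ B = 0 ∧ P.left.α₀ = 0 ∧ P.right.α₀ = 0 := by
    rcases le_total 0 (A * B) with hAB | hAB
    · obtain ⟨h1, h2, h3⟩ := right hAB
      exact ⟨h1, h2, (left (by simp [h2])).2.2, h3⟩
    · obtain ⟨h1, h2, h3⟩ := left (by linarith)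
      rw [neg_eq_zero] at h2
      exact ⟨h1, h2, h3, (right (by simp [h2])).2.2⟩
  refine ⟨hl0, ha, ha', A, hne.resolve_right (not_not.2 hB0), fun x hx => ?_⟩
  rw [(hrep x hx).1, (hrep x hx).2, hB0, hl0, hC0 hl0]
  simp

/-! ### The phase function of a problem -/

/-- The phase function: the eigenvalues are the `s ^ 2` with `s ≥ 0` and `phase s ∈ {π, 2π, …}`. -/
def phase (P : Problem) (s : ℝ) : ℝ := 2 * s + P.right.shift s + P.left.reflect.shift s

theorem Admissible.reflect_left (hP : P.Admissible) : P.left.reflect.Admissible 1 := by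
  simpa using hP.left.reflect

theorem Admissible.continuousOn_phase (hP : P.Admissible) : ContinuousOn P.phase (Ici 0) :=
  ((continuousOn_const.mul continuousOn_id).add hP.right.continuousOn_shift).add
    hP.reflect_left.continuousOn_shift

theorem Admissible.strictMonoOn_phase (hP : P.Admissible) : StrictMonoOn P.phase (Ici 0) := by
  refine strictMonoOn_of_deriv_pos (convex_Ici 0) hP.continuousOn_phase fun s hs => ?_
  rw [interior_Ici] at hs
  obtain ⟨d, hd, hd0⟩ := hP.right.hasDerivAt_shift hs
  obtain ⟨d', hd', hd0'⟩ := hP.reflect_left.hasDerivAt_shift hs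
  have := ((((hasDerivAt_id s).const_mul 2).add hd).add hd').deriv
  rw [show P.phase = _ from rfl]
  refine lt_of_lt_of_eq ?_ this.symm
  linarith

/-- The phase starts at 0, π/2 or π, so the first level that counts is π, attained at s = 0 exactly
when both α₀ vanish. -/
theorem Admissible.phase_zero (hP : P.Admissible) :
    P.phase 0 = (if P.right.α₀ = 0 then Real.pi / 2 else 0) +
      (if P.left.α₀ = 0 then Real.pi / 2 else 0) := by
  unfold phase
  rw [hP.right.shift_zero, hP.reflect_left.shift_zero, mul_zero, zero_add]
  rfl

theorem Admissible.phase_zero_nonneg (hP : P.Admissible) : 0 ≤ P.phase 0 := by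
  have := Real.pi_pos
  rw [hP.phase_zero]
  split_ifs <;> positivity

theorem abs_phase_sub_le (P : Problem) (s : ℝ) : |P.phase s - 2 * s| ≤ 2 * Real.pi := by
  have h1 := abs_le.1 (Complex.abs_arg_le_pi (P.right.normSymbol s))
  have h2 := abs_le.1 (Complex.abs_arg_le_pi (P.left.reflect.normSymbol s))
  unfold phase EndCondition.shift
  rw [abs_le]
  constructor <;> linarith

theorem Admissible.phase_zero_le (hP : P.Admissible) : P.phase 0 ≤ Real.pi := by
  have := Real.pi_pos
  rw [hP.phase_zero]
  split_ifs <;> linarith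

theorem Admissible.exists_phase_eq (hP : P.Admissible) (k : ℕ) :
    ∃ s, 0 ≤ s ∧ P.phase s = (k + 1) * Real.pi := by
  have hk : (0 : ℝ) ≤ k * Real.pi := by positivity
  have hb : (0 : ℝ) ≤ (k + 3) * Real.pi := by positivity
  have := intermediate_value_Icc hb (hP.continuousOn_phase.mono Icc_subset_Ici_self)
  obtain ⟨s, hs, h⟩ := this (show (k + 1) * Real.pi ∈ _ from
    ⟨by linarith [hP.phase_zero_le], by
      have := (abs_le.1 (P.abs_phase_sub_le ((k + 3) * Real.pi))).1
      nlinarith [Real.pi_pos]⟩)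
  exact ⟨s, hs.1, h⟩

theorem Admissible.exists_nat_of_sin_phase (hP : P.Admissible) {s : ℝ} (hs : 0 < s)
    (h : Real.sin (P.phase s) = 0) : ∃ k : ℕ, P.phase s = (k + 1) * Real.pi := by
  obtain ⟨n, hn⟩ := Real.sin_eq_zero_iff.1 h
  have hpos : 0 < P.phase s := hP.phase_zero_nonneg.trans_lt
    (hP.strictMonoOn_phase (mem_Ici.2 le_rfl) (mem_Ici.2 hs.le) hs)
  rw [← hn] at hpos
  have hn0 : 0 < n := by
    exact_mod_cast pos_of_mul_pos_left hpos Real.pi_pos.le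
  obtain ⟨k, hk⟩ := Int.eq_ofNat_of_zero_le (show 0 ≤ n - 1 by lia)
  obtain rfl : n = k + 1 := by lia
  exact ⟨k, by rw [← hn]; push_cast; ring⟩

/-- Shape of the eigenfunctions, and the equation for the eigenvalues. -/
theorem IsEigenfunction.form (hP : P.Admissible) {s : ℝ} (hs : 0 ≤ s) {u : ℝ → ℝ}
    (h : P.IsEigenfunction (s ^ 2) u) :
    (∃ R ≠ 0, ∀ x ∈ I, u x = R * Real.sin (s * (x - 1) - P.right.shift s) ∧
      D1 u x = R * (s * Real.cos (s * (x - 1) - P.right.shift s))) ∧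
    ∃ k : ℕ, P.phase s = (k + 1) * Real.pi := by
  rcases hs.eq_or_lt with rfl | hs
  -- At s = 0 both shifts are π/2, so the constant c is -c · sin(-π/2) and the sine formula
  -- persists.
  · obtain ⟨-, ha, ha', c, hc, hrep⟩ := h.of_nonpos hP (by norm_num)
    refine ⟨⟨-c, neg_ne_zero.2 hc, fun x hx => ?_⟩, 0, ?_⟩
    · rw [hP.right.shift_zero, if_pos ha', (hrep x hx).1, (hrep x hx).2]
      simp
    · rw [hP.phase_zero, if_pos ha, if_pos ha']
      simp
  have hd : ∀ x, HasDerivAt (fun x : ℝ => s * x) s x := fun x => by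
    simpa using (hasDerivAt_id x).const_mul s
  obtain ⟨A, B, hne, hrep⟩ := h.exists_rep (C := fun x => Real.cos (s * x))
    (S := fun x => Real.sin (s * x) / s)
    (fun x => (hd x).cos.congr_deriv (by field_simp))
    (fun x => ((hd x).sin.div_const s).congr_deriv (by field_simp))
    (fun x => by
      have := Real.cos_sq_add_sin_sq (s * x)
      field_simp
      linarith)
  obtain ⟨R, θ, hR, hc, hsn⟩ : ∃ R θ : ℝ, R ≠ 0 ∧ R * Real.cos θ = B / s ∧ R * Real.sin θ = A := by
    refine ⟨‖(⟨B / s, A⟩ : ℂ)‖, (⟨B / s, A⟩ : ℂ).arg, ?_, Complex.norm_mul_cos_arg _,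
      Complex.norm_mul_sin_arg _⟩
    rw [norm_ne_zero_iff]
    intro h0
    have h1 := congrArg Complex.re h0
    have h2 := congrArg Complex.im h0
    simp only [Complex.zero_re, Complex.zero_im, div_eq_zero_iff, hs.ne', or_false] at h1 h2
    exact hne.elim (fun h => h h2) fun h => h h1
  set φ := θ + s with hφ
  have hform : ∀ x ∈ I, u x = R * Real.sin (s * (x - 1) + φ) ∧
      D1 u x = R * (s * Real.cos (s * (x - 1) + φ)) := by
    intro x hx
    rw [(hrep x hx).1, (hrep x hx).2, show s * (x - 1) + φ = s * x + θ by rw [hφ]; ring,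
      Real.sin_add, Real.cos_add]
    have hB : B = s * (R * Real.cos θ) := by
      rw [hc]
      field_simp
    rw [hB, ← hsn]
    constructor <;> field_simp <;> ring
  have hr := EndCondition.Balanced.congr h.bc_right hP.right.η_mem (by norm_num)
    (fun x hx => (hform x hx).1) (fun x hx => (hform x hx).2)
  have hl := EndCondition.Balanced.congr h.bc_left hP.left.η_mem (by norm_num)
    (fun x hx => (hform x hx).1) (fun x hx => (hform x hx).2)
  rw [EndCondition.balanced_const_mul hR, hP.right.balanced_sine hs] at hr
  rw [EndCondition.balanced_const_mul hR, hP.left.balanced_sine_left hs] at hl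
  obtain ⟨n, hn⟩ := Real.sin_eq_zero_iff.1 hr
  refine ⟨⟨(-1) ^ n * R, mul_ne_zero (zpow_ne_zero _ (by norm_num)) hR, fun x hx => ?_⟩,
    hP.exists_nat_of_sin_phase hs ?_⟩
  · rw [(hform x hx).1, (hform x hx).2,
      show s * (x - 1) + φ = s * (x - 1) - P.right.shift s + n * Real.pi by rw [hn]; ring,
      Real.sin_add_int_mul_pi, Real.cos_add_int_mul_pi]
    constructor <;> ring
  · rw [show P.phase s = 2 * s - φ + P.left.reflect.shift s + n * Real.pi by
      rw [hn, phase]; ring, Real.sin_add_int_mul_pi, hl, mul_zero]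

theorem Admissible.sq_mem_spec (hP : P.Admissible) {s : ℝ} (hs : 0 ≤ s) {k : ℕ}
    (h : P.phase s = (k + 1) * Real.pi) : s ^ 2 ∈ P.spec := by
  have hpi := Real.pi_pos
  rcases hs.eq_or_lt with rfl | hs
  · have h0 := hP.phase_zero
    rw [h] at h0
    have hk : (0 : ℝ) ≤ k * Real.pi := by positivity
    obtain ⟨ha, ha'⟩ : P.left.α₀ = 0 ∧ P.right.α₀ = 0 := by
      by_contra hc
      split_ifs at h0 <;> first | tauto | linarith
    have hb : ∀ (E : EndCondition) (ν : ℝ), E.Admissible ν → E.α₀ = 0 →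
        E.Balanced ν (fun _ => 1) (fun _ => 0) := fun E ν hE h0 => by
      simp [EndCondition.Balanced, h0, hE.α_eq_zero h0]
    refine ⟨fun _ => 1, isEigenfunction_of_hasDerivAt (w := fun _ => 0)
      (fun x => hasDerivAt_const x _) (fun x => ?_) contDiff_const hP (hb _ _ hP.left ha)
      (hb _ _ hP.right ha') ⟨0, by norm_num, one_ne_zero⟩⟩
    simpa using hasDerivAt_const x (0 : ℝ)
  set φ := -P.right.shift s with hφ
  have hd : ∀ x, HasDerivAt (fun x : ℝ => s * (x - 1) + φ) s x := fun x => by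
    simpa using (((hasDerivAt_id x).sub_const 1).const_mul s).add_const φ
  refine ⟨fun x => Real.sin (s * (x - 1) + φ), isEigenfunction_of_hasDerivAt
    (w := fun x => s * Real.cos (s * (x - 1) + φ)) (fun x => ?_) (fun x => ?_) ?_ hP ?_ ?_ ?_⟩
  · refine (hd x).sin.congr_deriv ?_
    ring
  · refine ((hd x).cos.const_mul s).congr_deriv ?_
    ring
  · exact Real.contDiff_sin.comp (by fun_prop)
  · rw [hP.left.balanced_sine_left hs, show 2 * s - φ + P.left.reflect.shift s = P.phase s by
      rw [hφ, phase]; ring, h]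
    exact_mod_cast Real.sin_nat_mul_pi (k + 1)
  · rw [hP.right.balanced_sine hs, hφ, neg_add_cancel, Real.sin_zero]
  · by_contra! hc
    have hsin : ∀ x ∈ I, Real.sin (s * (x - 1) + φ) = 0 := hc
    -- This keeps 1 - δ in the interval and 0 < sδ ≤ 1 < π, so two zeros at distance δ are
    -- impossible.
    set δ := min 1 (1 / s) with hδ
    have hδ0 : 0 < δ := by positivity
    have h1 := hsin 1 (by norm_num)
    have h2 := hsin (1 - δ) ⟨by linarith [min_le_left 1 (1 / s)], by linarith⟩
    have hsd : s * δ ≤ 1 := by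
      calc s * δ ≤ s * (1 / s) := mul_le_mul_of_nonneg_left (min_le_right _ _) hs.le
        _ = 1 := by field_simp
    have h3 : Real.sin (s * δ) = 0 := by
      rw [show s * δ = s * (1 - 1) + φ - (s * (1 - δ - 1) + φ) by ring, Real.sin_sub, h1, h2]
      ring
    exact (Real.sin_pos_of_pos_of_lt_pi (mul_pos hs hδ0)
      (by linarith [Real.pi_gt_three])).ne' h3

/-- The `k`-th eigenvalue is `root k ^ 2`. -/
def root (P : Problem) (k : ℕ) : ℝ :=
  Classical.epsilon fun s => 0 ≤ s ∧ P.phase s = (k + 1) * Real.pi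

theorem Admissible.root_spec (hP : P.Admissible) (k : ℕ) :
    0 ≤ P.root k ∧ P.phase (P.root k) = (k + 1) * Real.pi :=
  Classical.epsilon_spec (hP.exists_phase_eq k)

theorem Admissible.eq_root (hP : P.Admissible) {s : ℝ} (hs : 0 ≤ s) {k : ℕ}
    (h : P.phase s = (k + 1) * Real.pi) : s = P.root k :=
  hP.strictMonoOn_phase.injOn hs (hP.root_spec k).1 (h.trans (hP.root_spec k).2.symm)

theorem Admissible.strictMono_root (hP : P.Admissible) : StrictMono P.root := by
  intro j k hjk
  rw [← hP.strictMonoOn_phase.lt_iff_lt (hP.root_spec j).1 (hP.root_spec k).1,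
    (hP.root_spec j).2, (hP.root_spec k).2]
  have : (j : ℝ) < k := by exact_mod_cast hjk
  nlinarith [Real.pi_pos]

theorem Admissible.strictMono_root_sq (hP : P.Admissible) :
    StrictMono fun k => P.root k ^ 2 := fun _ _ hjk =>
  pow_lt_pow_left₀ (hP.strictMono_root hjk) (hP.root_spec _).1 (by norm_num)

theorem Admissible.range_root_sq (hP : P.Admissible) : range (fun k => P.root k ^ 2) = P.spec := by
  ext lam
  constructor
  · rintro ⟨k, rfl⟩
    exact hP.sq_mem_spec (hP.root_spec k).1 (hP.root_spec k).2
  · rintro ⟨u, hu⟩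
    have hl : 0 ≤ lam := by
      by_contra! hc
      exact hc.ne (hu.of_nonpos hP hc.le).1
    rw [← Real.sq_sqrt hl] at hu ⊢
    obtain ⟨-, k, hk⟩ := hu.form hP (Real.sqrt_nonneg _)
    exact ⟨k, by rw [hP.eq_root (Real.sqrt_nonneg _) hk]⟩

theorem Admissible.eigenvalue_eq_sq (hP : P.Admissible) (k : ℕ) :
    P.eigenvalue k = P.root k ^ 2 :=
  P.eigenvalue_eq hP.strictMono_root_sq hP.range_root_sq k

theorem Admissible.hasSimpleSpectrum (hP : P.Admissible) : P.HasSimpleSpectrum := by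
  have he : P.eigenvalue = fun k => P.root k ^ 2 := funext hP.eigenvalue_eq_sq
  refine ⟨he ▸ hP.strictMono_root_sq, he ▸ hP.range_root_sq, fun k u v hu hv => ?_⟩
  rw [hP.eigenvalue_eq_sq] at hu hv
  obtain ⟨⟨R, hR, h1⟩, -⟩ := hu.form hP (hP.root_spec k).1
  obtain ⟨⟨R', -, h2⟩, -⟩ := hv.form hP (hP.root_spec k).1
  refine ⟨R' / R, fun x hx => ?_⟩
  simp only
  rw [(h1 x hx).1, (h2 x hx).1]
  field_simp

end Problem

/-! ### Bounds for the phase shifts -/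

namespace EndCondition

variable {E : EndCondition}

theorem norm_symbol_sub_le (E : EndCondition) {s : ℝ} (hs : 0 ≤ s) :
    ‖(E.α₀ + (s * E.β₀ : ℝ) * Complex.I) - E.symbol s‖ ≤ ∑ i, |E.α i| + s * ∑ i, |E.β i| := by
  rw [symbol, sub_sub_cancel]
  refine (norm_sum_exp_le _ _).trans ?_
  rw [Finset.mul_sum, ← Finset.sum_add_distrib]
  exact Finset.sum_le_sum fun i _ => norm_coeff_le _ _ hs

/-- The hypothesis makes the imaginary part of the symbol positive. It holds for every s > 0 if α =
0, and for large s whenever β₀ > 0. -/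
theorem Admissible.shift_mem_of_sum_α_lt (h : E.Admissible 1) {s : ℝ} (hs : 0 < s)
    (hlt : ∑ i, |E.α i| < s * (E.β₀ - ∑ i, |E.β i|)) : E.shift s ∈ Ioo 0 Real.pi := by
  have h1 := (le_abs_self _).trans ((Complex.abs_im_le_norm _).trans (E.norm_symbol_sub_le hs.le))
  have h2 : 0 < (E.symbol s).im := by
    simp at h1
    linarith
  rw [← arg_symbol h hs]
  refine ⟨(Complex.arg_nonneg_iff.2 h2.le).lt_of_ne' fun h0 => ?_,
    Complex.arg_lt_pi_iff.2 (Or.inr h2.ne')⟩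
  exact h2.ne' (Complex.arg_eq_zero_iff.1 h0).2

theorem Admissible.shift_mem_of_α_eq_zero (h : E.Admissible 1) (hα : E.α = 0) (hβ : 0 < E.β₀)
    {s : ℝ} (hs : 0 ≤ s) (h0 : 0 < s ∨ E.α₀ = 0) : E.shift s ∈ Ioo 0 Real.pi := by
  rcases hs.eq_or_lt with rfl | hs
  · have := Real.pi_pos
    rw [h.shift_zero, if_pos (h0.resolve_left (lt_irrefl _))]
    constructor <;> linarith
  · refine h.shift_mem_of_sum_α_lt hs ?_
    simp only [hα, Pi.zero_apply, abs_zero, Finset.sum_const_zero]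
    exact mul_pos hs (sub_pos.2 (h.sum_β_lt hβ))

theorem Admissible.eventually_shift_mem (h : E.Admissible 1) (hβ : 0 < E.β₀) :
    ∀ᶠ s in atTop, E.shift s ∈ Ioo 0 Real.pi := by
  have hd := sub_pos.2 (h.sum_β_lt hβ)
  filter_upwards [eventually_gt_atTop 0,
    eventually_gt_atTop ((∑ i, |E.α i|) / (E.β₀ - ∑ i, |E.β i|))] with s hs hs'
  exact h.shift_mem_of_sum_α_lt hs ((div_lt_iff₀ hd).1 hs')

/-- With β = 0 the real part of the symbol is at least α₀ - Σ|αᵢ| > 0. -/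
theorem Admissible.abs_shift_lt (h : E.Admissible 1) (hβ : E.β = 0) (hα : 0 < E.α₀) {s : ℝ}
    (hs : 0 ≤ s) : |E.shift s| < Real.pi / 2 := by
  have h1 := (le_abs_self _).trans ((Complex.abs_re_le_norm _).trans (E.norm_symbol_sub_le hs))
  have h2 := h.sum_α_lt hα
  rw [shift, normSymbol, if_neg hα.ne', Complex.abs_arg_lt_pi_div_two_iff]
  left
  simp [hβ] at h1
  linarith

end EndCondition

/-! ### Nodal properties -/

/-- The argument of the sine increases from g' - (k+1)π to -g, and strictly between these lie
exactly the multiples -kπ, …, -π. -/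
theorem encard_zeros {s g g' : ℝ} {k : ℕ} (hs : 0 < s) (hg : g ∈ Ioo 0 Real.pi)
    (hg' : g' ∈ Ioo 0 Real.pi) (h : 2 * s + g + g' = (k + 1) * Real.pi) :
    {x | x ∈ Ioo (-1 : ℝ) 1 ∧ Real.sin (s * (x - 1) - g) = 0}.encard = k := by
  have hpi := Real.pi_pos
  set f : ℕ → ℝ := fun n => 1 + (g - (n + 1) * Real.pi) / s with hf
  have hinj : Function.Injective f := by
    intro a b hab
    simp only [hf, add_right_inj, div_left_inj' hs.ne', sub_right_inj,
      mul_left_inj' hpi.ne', add_left_inj, Nat.cast_inj] at hab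
    exact hab
  have hval : ∀ n, s * (f n - 1) = g - (n + 1) * Real.pi := fun n => by
    simp only [hf]
    field_simp
    ring
  have himg : {x | x ∈ Ioo (-1 : ℝ) 1 ∧ Real.sin (s * (x - 1) - g) = 0} = f '' Iio k := by
    ext x
    constructor
    · rintro ⟨hx, hx0⟩
      obtain ⟨n, hn⟩ := Real.sin_eq_zero_iff.1 hx0
      have h1 : s * (x - 1) < 0 := mul_neg_of_pos_of_neg hs (by linarith [hx.2])
      have h2 : s * (-2) < s * (x - 1) := mul_lt_mul_of_pos_left (by linarith [hx.1]) hs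
      have hn1 : (n : ℝ) < 0 := by
        by_contra! hc
        nlinarith [hg.1, mul_nonneg hc hpi.le]
      have hn2 : -((k : ℝ) + 1) < n := by
        by_contra! hc
        nlinarith [hg'.1, mul_le_mul_of_nonneg_right hc hpi.le]
      have hn1' : n < 0 := by exact_mod_cast hn1
      have hn2' : -((k : ℤ) + 1) < n := by exact_mod_cast hn2
      obtain ⟨j, hj⟩ := Int.eq_ofNat_of_zero_le (show 0 ≤ -n - 1 by lia)
      refine ⟨j, by simp only [mem_Iio]; lia, ?_⟩
      have hnj : (n : ℝ) = -(j + 1) := by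
        have : n = -(j + 1) := by lia
        rw [this]
        push_cast
        ring
      have : s * (f j - 1) = s * (x - 1) := by
        rw [hval]
        rw [hnj] at hn
        linarith
      linarith [mul_left_cancel₀ hs.ne' this]
    · rintro ⟨n, hn, rfl⟩
      have hnk : (n : ℝ) + 1 ≤ k := by exact_mod_cast hn
      have hn0 : (0 : ℝ) ≤ n := n.cast_nonneg
      have hv := hval n
      refine ⟨⟨?_, ?_⟩, ?_⟩
      · have : s * (-2) < s * (f n - 1) := by
          rw [hv]
          nlinarith [hg'.2]
        linarith [lt_of_mul_lt_mul_left this hs.le]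
      · have : s * (f n - 1) < s * 0 := by
          rw [hv]
          nlinarith [hg.2]
        linarith [lt_of_mul_lt_mul_left this hs.le]
      · rw [hv, show g - (n + 1) * Real.pi - g = -(((n + 1 : ℕ) : ℝ) * Real.pi) by push_cast; ring,
          Real.sin_neg, Real.sin_nat_mul_pi, neg_zero]
  rw [himg, hinj.encard_image, ← Finset.coe_Iio, encard_coe_eq_coe_finsetCard, Nat.card_Iio]

theorem D1_neg (u : ℝ → ℝ) : D1 (-u) = -D1 u := funext fun _ => derivWithin.neg

theorem D2_neg (u : ℝ → ℝ) : D2 (-u) = -D2 u := by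
  unfold D2
  rw [D1_neg]
  exact D1_neg _

theorem mem_S {u : ℝ → ℝ} {k : ℕ} (hu : ContDiffOn ℝ 2 u I) (h0 : u (-1) ≠ 0) (h1 : u 1 ≠ 0)
    (hs : ∀ x ∈ Ioo (-1 : ℝ) 1, u x = 0 → D1 u x ≠ 0)
    (hc : {x | x ∈ Ioo (-1 : ℝ) 1 ∧ u x = 0}.encard = k) : u ∈ S k := by
  rcases h0.lt_or_gt with h | h
  · exact Or.inr ⟨hu.neg, by simpa using h0, by simpa using h1, by simpa using h,
      by simpa [D1_neg] using hs, by simpa using hc⟩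
  · exact Or.inl ⟨hu, h0, h1, h, hs, hc⟩

theorem mem_T {u : ℝ → ℝ} {k : ℕ} (hu : ContDiffOn ℝ 2 u I) (h0 : D1 u (-1) ≠ 0)
    (h1 : D1 u 1 ≠ 0) (hs : ∀ x ∈ Ioo (-1 : ℝ) 1, D1 u x = 0 → D2 u x ≠ 0)
    (hc : {x | x ∈ Ioo (-1 : ℝ) 1 ∧ D1 u x = 0}.encard = k)
    (hz : ∀ x ∈ Ioo (-1 : ℝ) 1, ∀ y ∈ Ioo (-1 : ℝ) 1, x < y → D1 u x = 0 → D1 u y = 0 →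
      ∃ z ∈ Ioo x y, u z = 0) : u ∈ T k := by
  rcases h0.lt_or_gt with h | h
  · refine Or.inr ⟨hu.neg, ?_⟩
    simp only [D1_neg, D2_neg, Pi.neg_apply, neg_eq_zero, ne_eq, neg_pos]
    exact ⟨h0, h1, h, hs, hc, fun x hx y hy hxy hx0 hy0 _ => hz x hx y hy hxy hx0 hy0⟩
  · exact Or.inl ⟨hu, h0, h1, h, hs, hc, fun x hx y hy hxy hx0 hy0 _ => hz x hx y hy hxy hx0 hy0⟩

theorem cos_ne_zero_of_sin_eq_zero {t : ℝ} (h : Real.sin t = 0) : Real.cos t ≠ 0 := by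
  intro hc
  have := Real.cos_sq_add_sin_sq t
  rw [h, hc] at this
  norm_num at this

/-- Between two zeros of the cosine there is a zero of the sine. -/
theorem exists_sin_eq_zero {a b : ℝ} (hab : a < b) (ha : Real.cos a = 0) (hb : Real.cos b = 0) :
    Real.sin (a + Real.pi / 2) = 0 ∧ a + Real.pi / 2 < b := by
  refine ⟨by rw [Real.sin_add_pi_div_two, ha], ?_⟩
  by_contra! hc
  have h1 : 0 < Real.sin (b - a) :=
    Real.sin_pos_of_pos_of_lt_pi (by linarith) (by linarith [Real.pi_pos])
  rw [Real.sin_sub, ha, hb] at h1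
  simp at h1

namespace Problem

variable {P : Problem}

theorem IsEigenfunction.mem_S (hP : P.Admissible) {s : ℝ} (hs : 0 ≤ s) {u : ℝ → ℝ}
    (h : P.IsEigenfunction (s ^ 2) u) {k : ℕ} (hk : P.phase s = (k + 1) * Real.pi)
    (hr : P.right.shift s ∈ Ioo 0 Real.pi) (hl : P.left.reflect.shift s ∈ Ioo 0 Real.pi) :
    u ∈ S k := by
  obtain ⟨⟨R, hR, hform⟩, -⟩ := h.form hP hs
  have hsr : Real.sin (P.right.shift s) ≠ 0 := (Real.sin_pos_of_mem_Ioo hr).ne'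
  have hsl : Real.sin (P.left.reflect.shift s) ≠ 0 := (Real.sin_pos_of_mem_Ioo hl).ne'
  have hset : {x | x ∈ Ioo (-1 : ℝ) 1 ∧ u x = 0} =
      {x | x ∈ Ioo (-1 : ℝ) 1 ∧ Real.sin (s * (x - 1) - P.right.shift s) = 0} := by
    ext x
    refine and_congr_right fun hx => ?_
    rw [(hform x (Ioo_subset_Icc_self hx)).1, mul_eq_zero_iff_left hR]
  refine MultiPoint.mem_S h.contDiffOn ?_ ?_ (fun x hx hx0 => ?_) ?_
  · rw [(hform (-1) (by norm_num)).1, show s * (-1 - 1) - P.right.shift s =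
      P.left.reflect.shift s - ((k + 1 : ℕ) : ℝ) * Real.pi by
        push_cast
        rw [← hk, phase]
        ring, Real.sin_sub_nat_mul_pi]
    exact mul_ne_zero hR (mul_ne_zero (pow_ne_zero _ (by norm_num)) hsl)
  · rw [(hform 1 (by norm_num)).1, sub_self, mul_zero, zero_sub, Real.sin_neg]
    exact mul_ne_zero hR (neg_ne_zero.2 hsr)
  · have hx' := Ioo_subset_Icc_self hx
    rw [(hform x hx').1, mul_eq_zero_iff_left hR] at hx0
    rw [(hform x hx').2]
    refine mul_ne_zero hR (mul_ne_zero ?_ (cos_ne_zero_of_sin_eq_zero hx0))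
    rintro rfl
    simp [hsr] at hx0
  · rw [hset]
    rcases hs.eq_or_lt with rfl | hs
    · have hk0 : k = 0 := by
        have h1 := hP.phase_zero_le
        rw [hk] at h1
        have h2 : (k : ℝ) < 1 := by
          by_contra! hc
          nlinarith [Real.pi_pos]
        exact_mod_cast Nat.lt_one_iff.1 (by exact_mod_cast h2)
      simp [hk0, hsr]
    · exact encard_zeros hs hr hl hk

theorem IsEigenfunction.mem_T (hP : P.Admissible) {s : ℝ} (hs : 0 ≤ s) {u : ℝ → ℝ}
    (h : P.IsEigenfunction (s ^ 2) u) {k : ℕ} (hk : P.phase s = (k + 1) * Real.pi)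
    (hr : |P.right.shift s| < Real.pi / 2) (hl : |P.left.reflect.shift s| < Real.pi / 2) :
    u ∈ T (k + 1) := by
  have hpi := Real.pi_pos
  obtain ⟨⟨R, hR, hform⟩, -⟩ := h.form hP hs
  have hcr : Real.cos (P.right.shift s) ≠ 0 := (Real.cos_pos_of_mem_Ioo (abs_lt.1 hr)).ne'
  have hcl : Real.cos (P.left.reflect.shift s) ≠ 0 := (Real.cos_pos_of_mem_Ioo (abs_lt.1 hl)).ne'
  rw [abs_lt] at hr hl
  replace hs : 0 < s := by
    have h1 : P.phase s = 2 * s + P.right.shift s + P.left.reflect.shift s := rfl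
    have h2 : 0 ≤ k * Real.pi := by positivity
    linarith [hr.2, hl.2]
  have hzero : ∀ x ∈ Ioo (-1 : ℝ) 1, D1 u x = 0 →
      Real.cos (s * (x - 1) - P.right.shift s) = 0 := fun x hx hx0 => by
    rwa [(hform x (Ioo_subset_Icc_self hx)).2, mul_eq_zero_iff_left hR,
      mul_eq_zero_iff_left hs.ne'] at hx0
  have hset : {x | x ∈ Ioo (-1 : ℝ) 1 ∧ D1 u x = 0} = {x | x ∈ Ioo (-1 : ℝ) 1 ∧
      Real.sin (s * (x - 1) - (P.right.shift s + Real.pi / 2)) = 0} := by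
    ext x
    refine and_congr_right fun hx => ?_
    rw [(hform x (Ioo_subset_Icc_self hx)).2, mul_eq_zero_iff_left hR,
      mul_eq_zero_iff_left hs.ne', ← sub_sub, Real.sin_sub_pi_div_two, neg_eq_zero]
  refine MultiPoint.mem_T h.contDiffOn ?_ ?_ (fun x hx hx0 => ?_) ?_
    fun x hx y hy hxy hx0 hy0 => ?_
  · rw [(hform (-1) (by norm_num)).2, show s * (-1 - 1) - P.right.shift s =
      P.left.reflect.shift s - ((k + 1 : ℕ) : ℝ) * Real.pi by
        push_cast
        rw [← hk, phase]
        ring, Real.cos_sub_nat_mul_pi]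
    exact mul_ne_zero hR (mul_ne_zero hs.ne' (mul_ne_zero (pow_ne_zero _ (by norm_num)) hcl))
  · rw [(hform 1 (by norm_num)).2, sub_self, mul_zero, zero_sub, Real.cos_neg]
    exact mul_ne_zero hR (mul_ne_zero hs.ne' hcr)
  · have hx' := Ioo_subset_Icc_self hx
    rw [h.D2_eq hx', (hform x hx').1]
    refine neg_ne_zero.2 (mul_ne_zero (by positivity) (mul_ne_zero hR fun h0 => ?_))
    exact cos_ne_zero_of_sin_eq_zero h0 (hzero x hx hx0)
  · rw [hset]
    -- Passing from cosine to sine adds π/2 to each shift, hence π to the phase: this is why u' has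
    -- k + 1 zeros.
    refine encard_zeros (g' := P.left.reflect.shift s + Real.pi / 2) hs
      ⟨by linarith [hr.1], by linarith [hr.2]⟩ ⟨by linarith [hl.1], by linarith [hl.2]⟩ ?_
    rw [phase] at hk
    push_cast
    linarith
  · obtain ⟨h1, h2⟩ := exists_sin_eq_zero
      (show s * (x - 1) - P.right.shift s < s * (y - 1) - P.right.shift s by nlinarith)
      (hzero x hx hx0) (hzero y hy hy0)
    -- A quarter period after a zero of u' comes a zero of u.
    set z := x + Real.pi / 2 / s with hz
    have hxz : x < z := by
      have : 0 < Real.pi / 2 / s := by positivity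
      linarith
    have hsz : s * (z - 1) = s * (x - 1) + Real.pi / 2 := by
      rw [hz]
      field_simp
      ring
    have hzy : z < y := by
      have : s * (z - 1) < s * (y - 1) := by
        rw [hsz]
        linarith
      linarith [lt_of_mul_lt_mul_left this hs.le]
    refine ⟨z, ⟨hxz, hzy⟩, ?_⟩
    rw [(hform z ⟨by linarith [hx.1], by linarith [hy.2]⟩).1, hsz,
      show s * (x - 1) + Real.pi / 2 - P.right.shift s =
        s * (x - 1) - P.right.shift s + Real.pi / 2 by ring, h1, mul_zero]

/-! ### The Dirichlet and Neumann eigenvalues -/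

theorem Admissible.eigenvalue_eq_of_phase (hP : P.Admissible) {s : ℝ} (hs : 0 ≤ s) {k : ℕ}
    (h : P.phase s = (k + 1) * Real.pi) : P.eigenvalue k = s ^ 2 := by
  rw [hP.eigenvalue_eq_sq, hP.eq_root hs h]

end Problem

theorem singlePoint_admissible {a b ν : ℝ} (hν : ν ≠ 0) (ha : 0 ≤ a) (hb : 0 ≤ ν * b)
    (hab : 0 < a + |b|) : (singlePoint a b).Admissible ν where
  one_le_m := le_rfl
  η_mem _ := show (0 : ℝ) ∈ I by norm_num
  η_ne _ := hν.symm
  α₀_nonneg := ha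
  nontrivial := hab
  β₀_sign := hb
  α_zero _ := by simp [singlePoint]
  β_zero _ := by simp [singlePoint]
  small := by simp [singlePoint]

theorem lamD_natCast (j : ℕ) : lamD j = ((j + 1) * Real.pi / 2) ^ 2 := by
  have hP : dirichlet.Admissible := ⟨singlePoint_admissible (by norm_num) (by norm_num)
    (by norm_num) (by norm_num), singlePoint_admissible (by norm_num) (by norm_num)
    (by norm_num) (by norm_num)⟩
  rw [lamD, if_pos (by positivity), Int.toNat_natCast]
  have := Real.pi_pos
  refine hP.eigenvalue_eq_of_phase (by positivity) ?_
  simp [Problem.phase, EndCondition.shift, EndCondition.normSymbol, EndCondition.symbol,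
    dirichlet, singlePoint, EndCondition.reflect]
  ring

theorem lamN_eq (j : ℕ) : lamN j = (j * Real.pi / 2) ^ 2 := by
  have hP : neumann.Admissible := ⟨singlePoint_admissible (by norm_num) (by norm_num)
    (by norm_num) (by norm_num), singlePoint_admissible (by norm_num) (by norm_num)
    (by norm_num) (by norm_num)⟩
  have := Real.pi_pos
  refine hP.eigenvalue_eq_of_phase (by positivity) ?_
  simp [Problem.phase, EndCondition.shift, EndCondition.normSymbol,
    neumann, singlePoint, EndCondition.reflect]
  ring

/-! ### Positivity and growth of the roots, comparison with the Dirichlet eigenvalues -/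

namespace Problem

variable {P : Problem}

theorem Admissible.root_pos_or (hP : P.Admissible) (k : ℕ) :
    0 < P.root k ∨ k = 0 ∧ P.left.α₀ = 0 ∧ P.right.α₀ = 0 ∧ P.root k = 0 := by
  have hpi := Real.pi_pos
  obtain ⟨h0, hk⟩ := hP.root_spec k
  rcases h0.eq_or_lt with h0 | h0
  · right
    rw [← h0] at hk ⊢
    have h1 := hP.phase_zero
    have h2 := hP.phase_zero_le
    rw [hk] at h1 h2
    have hk0 : (0 : ℝ) ≤ k * Real.pi := by positivity
    refine ⟨?_, ?_⟩
    · have : (k : ℝ) < 1 := by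
        by_contra! hc
        nlinarith
      exact Nat.lt_one_iff.1 (by exact_mod_cast this)
    · by_contra hc
      split_ifs at h1 <;> first | tauto | linarith
  · exact Or.inl h0

/-- Shifts in (0, π) place 2s strictly between (k-1)π and (k+1)π. For k < 2 the lower bound is the
convention 0, hence the condition that the root be positive. -/
theorem Admissible.lamD_bounds (hP : P.Admissible) {k : ℕ}
    (hr : P.right.shift (P.root k) ∈ Ioo 0 Real.pi)
    (hl : P.left.reflect.shift (P.root k) ∈ Ioo 0 Real.pi) :
    (0 < P.root k → lamD ((k : ℤ) - 2) < P.eigenvalue k) ∧ P.eigenvalue k < lamD k := by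
  have hpi := Real.pi_pos
  obtain ⟨h0, hk⟩ := hP.root_spec k
  rw [phase] at hk
  rw [hP.eigenvalue_eq_sq, lamD_natCast]
  refine ⟨fun hpos => ?_, pow_lt_pow_left₀ (by linarith [hr.1, hl.1]) h0 (by norm_num)⟩
  rcases lt_or_ge k 2 with h2 | h2
  · rw [lamD, if_neg (by lia)]
    positivity
  · obtain ⟨j, rfl⟩ := Nat.exists_eq_add_of_le' h2
    rw [show ((j + 2 : ℕ) : ℤ) - 2 = (j : ℕ) by push_cast; ring, lamD_natCast]
    refine pow_lt_pow_left₀ ?_ (by positivity) (by norm_num)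
    push_cast at hk
    linarith [hr.2, hl.2]

theorem Admissible.tendsto_root (hP : P.Admissible) : Tendsto P.root atTop atTop := by
  have hpi := Real.pi_pos
  refine tendsto_atTop_mono (f := fun k : ℕ => (k : ℝ) * (Real.pi / 2) - Real.pi) (fun k => ?_) ?_
  · have := (abs_le.1 (P.abs_phase_sub_le (P.root k))).2
    rw [(hP.root_spec k).2] at this
    linarith
  · exact tendsto_atTop_add_const_right _ _
      (tendsto_natCast_atTop_atTop.atTop_mul_const (by positivity))

end Problem

end MultiPoint

end

theorem mainTheorem7 (P : MultiPoint.Problem) (hP : P.Admissible) :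
    -- (a)
    (0 < P.left.α₀ → 0 < P.right.α₀ → P.left.β = 0 → P.right.β = 0 →
      P.HasSimpleSpectrum ∧
      ∀ k : ℕ,
        (∀ ψ, P.IsEigenfunction (P.eigenvalue k) ψ → ψ ∈ MultiPoint.T (k + 1)) ∧
        MultiPoint.lamN k < P.eigenvalue k ∧ P.eigenvalue k < MultiPoint.lamN (k + 2)) ∧
    -- (b)
    (P.left.α = 0 → P.right.α = 0 → P.left.β₀ < 0 → 0 < P.right.β₀ →
      P.HasSimpleSpectrum ∧
      (∀ k : ℕ,
        (∀ ψ, P.IsEigenfunction (P.eigenvalue k) ψ → ψ ∈ MultiPoint.S k) ∧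
        (¬ (k = 0 ∧ P.left.α₀ = 0 ∧ P.right.α₀ = 0) →
          MultiPoint.lamD ((k : ℤ) - 2) < P.eigenvalue k) ∧
        P.eigenvalue k < MultiPoint.lamD k) ∧
      (P.left.α₀ = 0 → P.right.α₀ = 0 → P.eigenvalue 0 = 0)) ∧
    -- (c)
    (P.left.β₀ < 0 → 0 < P.right.β₀ →
      P.HasSimpleSpectrum ∧
      ∀ᶠ k : ℕ in Filter.atTop,
        (∀ ψ, P.IsEigenfunction (P.eigenvalue k) ψ → ψ ∈ MultiPoint.S k) ∧
        MultiPoint.lamD ((k : ℤ) - 2) < P.eigenvalue k ∧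
        P.eigenvalue k < MultiPoint.lamD k) := by
  have hpi := Real.pi_pos
  have hPl := hP.reflect_left
  refine ⟨fun hl hr hβl hβr => ⟨hP.hasSimpleSpectrum, fun k => ?_⟩,
    fun hαl hαr hl hr => ⟨hP.hasSimpleSpectrum, fun k => ?_, fun hl0 hr0 => ?_⟩,
    fun hl hr => ⟨hP.hasSimpleSpectrum, ?_⟩⟩
  · obtain ⟨h0, hk⟩ := hP.root_spec k
    have h1 := hP.right.abs_shift_lt hβr hr h0
    have h2 := hPl.abs_shift_lt
      (show P.left.reflect.β = 0 by simp [MultiPoint.EndCondition.reflect, hβl]; rfl) hl h0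
    refine ⟨fun ψ hψ => ?_, ?_⟩
    · rw [hP.eigenvalue_eq_sq] at hψ
      exact hψ.mem_T hP h0 hk h1 h2
    · rw [abs_lt] at h1 h2
      rw [MultiPoint.Problem.phase] at hk
      rw [hP.eigenvalue_eq_sq, MultiPoint.lamN_eq, MultiPoint.lamN_eq]
      push_cast
      -- Shifts in (-π/2, π/2) place 2s strictly between kπ and (k+2)π.
      constructor <;> refine pow_lt_pow_left₀ ?_ (by positivity) (by norm_num)
      · linarith
      · linarith
  · obtain ⟨h0, hk⟩ := hP.root_spec k
    have hpos := hP.root_pos_or k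
    have h1 := hP.right.shift_mem_of_α_eq_zero hαr hr h0 (hpos.imp_right fun h => h.2.2.1)
    have h2 := hPl.shift_mem_of_α_eq_zero hαl (neg_pos.2 hl) h0 (hpos.imp_right fun h => h.2.1)
    obtain ⟨hlow, hup⟩ := hP.lamD_bounds h1 h2
    refine ⟨fun ψ hψ => ?_, fun hne => hlow (hpos.resolve_right fun h => ?_), hup⟩
    · rw [hP.eigenvalue_eq_sq] at hψ
      exact hψ.mem_S hP h0 hk h1 h2
    · exact hne ⟨h.1, h.2.1, h.2.2.1⟩
  -- With both α₀ zero, the phase already equals π at s = 0.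
  · rw [hP.eigenvalue_eq_of_phase le_rfl (k := 0)
      (by rw [hP.phase_zero, if_pos hl0, if_pos hr0]; push_cast; ring)]
    norm_num
  -- Since the roots tend to infinity, statements valid for large s become statements for large k.
  · filter_upwards [hP.tendsto_root.eventually (hP.right.eventually_shift_mem hr),
      hP.tendsto_root.eventually (hPl.eventually_shift_mem (neg_pos.2 hl)),
      hP.tendsto_root.eventually (eventually_gt_atTop 0)] with k h1 h2 hpos
    obtain ⟨h0, hk⟩ := hP.root_spec k
    obtain ⟨hlow, hup⟩ := hP.lamD_bounds h1 h2
    refine ⟨fun ψ hψ => ?_, hlow hpos, hup⟩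
    rw [hP.eigenvalue_eq_sq] at hψ
    exact hψ.mem_S hP h0 hk h1 h2
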